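/- **Setting.** Let $V$ be a finite-dimensional complex vector space, $W\subset GL(V)$ a finite complex reflection group, $W_0\subseteq W$ a reflection subgroup (i.e. a subgroup generated by the reflections it contains), and $N=N_W(W_0)$. Let $\mathcal A\supseteq\mathcal A_0$ be the sets of reflecting hyperplanes of $W$ and of $W_0$. For $H\in\mathcal A$ choose $\alpha_H\in V^*$ with $\ker\alpha_H=H$; put $\delta=\prod_{H\in\mathcal A}\alpha_H\in\mathbb C[V]$, $X=V\setminus\bigcup_{H\in\mathcal A}H$, $\mathbb C[X]=\mathbb C[V][\delta^{-1}]$, and let $\mathcal D(X)$ be the algebra of algebraic differential operators on $X$, on which $N$ acts. For $H\in\mathcal A_0$ let $N_H$ be the pointwise stabiliser of $H$ in $N$ (it equals the pointwise stabiliser of $H$ in $W$ whenever the latter is contained in $N$, in particular if $W_0$ contains every reflection of $W$ whose hyperplane is in $\mathcal A_0$), let $m_H=|N_H|$, and let $v_H\in V$ be such that $\mathbb C v_H\oplus H=V$ and $\mathbb C v_H$ is stable under the pointwise stabiliser of $H$ in $W$. Let $k_{H,j}\in\mathbb C$ ($H\in\mathcal A_0$, $j\in\mathbb Z/m_H$)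 satisfy $k_{g(H),j}=k_{H,j}$ for $g\in N$, and put in $\mathbb CN$ $$\epsilon_{H,j}=\frac1{m_H}\sum_{w\in N_H}\det(w)^j w,\qquad \gamma_H=\sum_{j=0}^{m_H-1}m_H(k_{H,j+1}-k_{H,j})\,\epsilon_{H,j},\qquad a_H=\sum_{j=0}^{m_H-1}m_Hk_{H,j}\,\epsilon_{H,j}.$$ The rational Cherednik algebra $A=A(W_0,W)$ is the quotient of $T(V\oplus V^*)\rtimes N$ by the relations, for $x,x'\in V^*$ and $y,y'\in V$, $$[x,x']=0,\qquad [y,y']=0,\qquad [y,x]=x(y)+\sum_{H\in\mathcal A_0}\frac{\alpha_H(y)\,x(v_H)}{\alpha_H(v_H)}\,\gamma_H .$$ For $y\in V$ the Dunkl operator is $$T_y=\partial_y+\sum_{H\in\mathcal A_0}\frac{\alpha_H(y)}{\alpha_H}\,a_H\in\mathcal D(X)\rtimes N .$$ **Theorem (Dunkl embedding).** (i) There is an injective morphism of algebras $\Phi:A(W_0,W)\to\mathcal D(X)\rtimes N$ with $\Phi(x)=x$, $\Phi(y)=T_y$ and $\Phi(w)=w$ for $x\in V^*$, $y\in V$,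 $w\in N$. (ii) The powers of $\delta$ form a left Ore set in $A(W_0,W)$; the localization $A(W_0,W)_{reg}=A(W_0,W)[\delta^{-1}]$ is identified, by $\delta^{-n}\otimes a\leftrightarrow\delta^{-n}a$, with $\mathbb C[X]\otimes_{\mathbb C[V]}A(W_0,W)$; and $\Phi$ extends to an isomorphism of algebras $$\Phi_{reg}:A(W_0,W)_{reg}\xrightarrow{\ \sim\ }\mathcal D(X)\rtimes N,\qquad \Phi_{reg}(f\otimes a)=f\,\Phi(a)\quad(f\in\mathbb C[X],\ a\in A(W_0,W)).$$ -/

import Mathlib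

open scoped TensorProduct

noncomputable section

/-! ### Reflections, reflection groups and hyperplane arrangements -/

section Reflections

variable {V : Type*} [AddCommGroup V] [Module ℂ V]

/-- The subspace `Ker (s - 1)` of `V`. -/
def fixedSpace (s : V ≃ₗ[ℂ] V) : Submodule ℂ V :=
  LinearMap.ker ((s : V →ₗ[ℂ] V) - LinearMap.id)

/-- A (complex) reflection: `Ker (s - 1)` is a hyperplane.  Finite order is automatic, since only
elements of finite groups are considered. -/
def IsReflection (s : V ≃ₗ[ℂ] V) : Prop :=
  Module.finrank ℂ (fixedSpace s) + 1 = Module.finrank ℂ V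

/-- A subgroup of `GL(V)` generated by the reflections that it contains. -/
def IsReflectionGroup (W : Subgroup (V ≃ₗ[ℂ] V)) : Prop :=
  Subgroup.closure {s | s ∈ W ∧ IsReflection s} = W

/-- The arrangement of the reflecting hyperplanes of `W`. -/
def arrangement (W : Subgroup (V ≃ₗ[ℂ] V)) : Set (Submodule ℂ V) :=
  {H | ∃ s ∈ W, IsReflection s ∧ fixedSpace s = H}

theorem arrangement_finite (W : Subgroup (V ≃ₗ[ℂ] V)) [Finite W] : (arrangement W).Finite := by
  refine (Set.finite_range (fun s : W => fixedSpace (s : V ≃ₗ[ℂ] V))).subset ?_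
  rintro H ⟨s, hs, -, rfl⟩
  exact ⟨⟨s, hs⟩, rfl⟩

theorem fixedSpace_conj (g s : V ≃ₗ[ℂ] V) :
    fixedSpace (g * s * g⁻¹) = (fixedSpace s).map (g : V →ₗ[ℂ] V) := by
  ext u
  simp only [fixedSpace, LinearMap.mem_ker, LinearMap.sub_apply, LinearMap.id_apply,
    LinearEquiv.coe_coe, sub_eq_zero, Submodule.mem_map, LinearEquiv.mul_apply]
  constructor
  · intro h
    refine ⟨g⁻¹ u, ?_, ?_⟩
    · apply g.injective
      rw [h]
      exact (g.apply_symm_apply u).symm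
    · exact g.apply_symm_apply u
  · rintro ⟨t, ht, rfl⟩
    have : g⁻¹ (g t) = t := g.symm_apply_apply t
    rw [this, ht]

theorem map_mem_arrangement {W : Subgroup (V ≃ₗ[ℂ] V)} {g : V ≃ₗ[ℂ] V} (hg : g ∈ W)
    {H : Submodule ℂ V} (hH : H ∈ arrangement W) :
    H.map (g : V →ₗ[ℂ] V) ∈ arrangement W := by
  obtain ⟨s, hs, hr, rfl⟩ := hH
  refine ⟨g * s * g⁻¹, W.mul_mem (W.mul_mem hg hs) (W.inv_mem hg), ?_, fixedSpace_conj g s⟩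
  unfold IsReflection at *
  rw [fixedSpace_conj, ← hr]
  congr 1
  exact LinearEquiv.finrank_map_eq g (fixedSpace s)

end Reflections

/-! ### Differential operators on a commutative algebra -/

section DiffOp

variable (R : Type*) [CommRing R] [Algebra ℂ R]

/-- `IsDiffOp R n θ`: the endomorphism `θ` of `R` is a differential operator of order `≤ n`
in the sense of Grothendieck. -/
def IsDiffOp : ℕ → Module.End ℂ R → Prop
  | 0, θ => ∀ f : R, θ * LinearMap.mulLeft ℂ f - LinearMap.mulLeft ℂ f * θ = 0
  | n + 1, θ => ∀ f : R, IsDiffOp n (θ * LinearMap.mulLeft ℂ f - LinearMap.mulLeft ℂ f * θ)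

variable {R}

theorem IsDiffOp.zero (n : ℕ) : IsDiffOp R n 0 := by
  induction n with
  | zero => intro f; simp
  | succ n ih => intro f; simpa using ih

theorem IsDiffOp.add {n : ℕ} {θ η : Module.End ℂ R} (h : IsDiffOp R n θ) (h' : IsDiffOp R n η) :
    IsDiffOp R n (θ + η) := by
  induction n generalizing θ η with
  | zero =>
    intro f
    have := congrArg₂ (· + ·) (h f) (h' f)
    simp only [add_zero] at this
    rw [← this]; noncomm_ring
  | succ n ih =>
    intro f
    have := ih (h f) (h' f)
    convert this using 1
    noncomm_ring

theorem IsDiffOp.succ {n : ℕ} {θ : Module.End ℂ R} (h : IsDiffOp R n θ) :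
    IsDiffOp R (n + 1) θ := by
  induction n generalizing θ with
  | zero => intro f; rw [h f]; exact IsDiffOp.zero 0
  | succ n ih => intro f; exact ih (h f)

theorem IsDiffOp.mono {m n : ℕ} (hmn : m ≤ n) {θ : Module.End ℂ R} (h : IsDiffOp R m θ) :
    IsDiffOp R n θ := by
  induction hmn with
  | refl => exact h
  | step _ ih => exact ih.succ

theorem isDiffOp_mulLeft (f : R) : IsDiffOp R 0 (LinearMap.mulLeft ℂ f) := by
  intro g
  ext u
  simp [mul_left_comm]

theorem IsDiffOp.mul_aux (N : ℕ) : ∀ {m n : ℕ} {θ η : Module.End ℂ R}, m + n = N →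
    IsDiffOp R m θ → IsDiffOp R n η → IsDiffOp R N (θ * η) := by
  induction N with
  | zero =>
    intro m n θ η hmn h h' f
    obtain ⟨rfl, rfl⟩ : m = 0 ∧ n = 0 := by omega
    have e1 := h f
    have e2 := h' f
    have : θ * η * LinearMap.mulLeft ℂ f - LinearMap.mulLeft ℂ f * (θ * η) =
      θ * (η * LinearMap.mulLeft ℂ f - LinearMap.mulLeft ℂ f * η) +
      (θ * LinearMap.mulLeft ℂ f - LinearMap.mulLeft ℂ f * θ) * η := by
      rw [mul_sub, sub_mul]; simp only [mul_assoc]; abel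
    rw [this, e1, e2]; simp
  | succ N ih =>
    intro m n θ η hmn h h' f
    have : θ * η * LinearMap.mulLeft ℂ f - LinearMap.mulLeft ℂ f * (θ * η) =
      θ * (η * LinearMap.mulLeft ℂ f - LinearMap.mulLeft ℂ f * η) +
      (θ * LinearMap.mulLeft ℂ f - LinearMap.mulLeft ℂ f * θ) * η := by
      rw [mul_sub, sub_mul]; simp only [mul_assoc]; abel
    rw [this]
    refine IsDiffOp.add ?_ ?_
    · cases n with
      | zero => rw [h' f, mul_zero]; exact IsDiffOp.zero N
      | succ n => exact ih (m := m) (n := n) (by omega) h (h' f)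
    · cases m with
      | zero => rw [h f, zero_mul]; exact IsDiffOp.zero N
      | succ m => exact ih (m := m) (n := n) (by omega) (h f) h'

theorem IsDiffOp.mul {m n : ℕ} {θ η : Module.End ℂ R} (h : IsDiffOp R m θ)
    (h' : IsDiffOp R n η) : IsDiffOp R (m + n) (θ * η) :=
  IsDiffOp.mul_aux (m + n) rfl h h'

variable (R)

/-- The algebra of (global, algebraic) differential operators on the affine variety with
coordinate ring `R`. -/
def diffOps : Subalgebra ℂ (Module.End ℂ R) where
  carrier := {θ | ∃ n, IsDiffOp R n θ}
  mul_mem' := by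
    rintro a b ⟨m, hm⟩ ⟨n, hn⟩
    exact ⟨m + n, hm.mul hn⟩
  add_mem' := by
    rintro a b ⟨m, hm⟩ ⟨n, hn⟩
    exact ⟨max m n, (hm.mono (le_max_left m n)).add (hn.mono (le_max_right m n))⟩
  algebraMap_mem' := by
    intro c
    refine ⟨0, ?_⟩
    intro f
    ext u
    simp [Module.algebraMap_end_apply]

/-- Multiplication by a function, as a differential operator. -/
def functionOp : R →ₐ[ℂ] diffOps R :=
  (Algebra.lmul ℂ R).codRestrict (diffOps R) fun f => ⟨0, isDiffOp_mulLeft f⟩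

variable {R}

/-- A derivation, as a differential operator. -/
def derivationOp (d : Derivation ℂ R R) : diffOps R :=
  ⟨(d : R →ₗ[ℂ] R), 1, by
    intro f g
    ext u
    simp only [Module.End.mul_apply, LinearMap.sub_apply, LinearMap.mulLeft_apply,
      Derivation.coeFn_coe, Derivation.leibniz, smul_eq_mul, LinearMap.zero_apply]
    ring⟩

theorem IsDiffOp.conj (σ : R ≃ₐ[ℂ] R) {n : ℕ} {θ : Module.End ℂ R} (h : IsDiffOp R n θ) :
    IsDiffOp R n (σ.toLinearMap * θ * σ.symm.toLinearMap) := by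
  have key : ∀ (θ : Module.End ℂ R) (f : R),
      (σ.toLinearMap * θ * σ.symm.toLinearMap) * LinearMap.mulLeft ℂ f -
        LinearMap.mulLeft ℂ f * (σ.toLinearMap * θ * σ.symm.toLinearMap) =
      σ.toLinearMap * (θ * LinearMap.mulLeft ℂ (σ.symm f) -
        LinearMap.mulLeft ℂ (σ.symm f) * θ) * σ.symm.toLinearMap := by
    intro θ f
    ext u
    simp [Module.End.mul_apply]
  induction n generalizing θ with
  | zero => intro f; rw [key, h]; simp
  | succ n ih => intro f; rw [key]; exact ih (h _)

/-- The action of an automorphism of `R` on the differential operators: `θ ↦ σ ∘ θ ∘ σ⁻¹`. -/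
def diffOpsConj (σ : R ≃ₐ[ℂ] R) : diffOps R →ₐ[ℂ] diffOps R where
  toFun θ := ⟨σ.toLinearMap * θ.1 * σ.symm.toLinearMap, by
    obtain ⟨n, hn⟩ := θ.2
    exact ⟨n, hn.conj σ⟩⟩
  map_one' := by ext u; simp
  map_mul' θ η := by ext u; simp [Module.End.mul_apply]
  map_zero' := by ext u; simp
  map_add' θ η := by ext u; simp [Module.End.mul_apply]
  commutes' c := by ext u; simp [Module.End.mul_apply, Module.algebraMap_end_apply]

end DiffOp

/-! ### Polynomial functions and tensors -/

section Polynomials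

variable (V : Type*) [AddCommGroup V] [Module ℂ V]

/-- The algebra `ℂ[V]` of polynomial functions on `V`. -/
abbrev PolyFun := SymmetricAlgebra ℂ (Module.Dual ℂ V)

variable {V}

/-- The contragredient action of `GL(V)` on `V*`: `g` sends `x` to `x ∘ g⁻¹`. -/
def dualAct (g : V ≃ₗ[ℂ] V) : Module.Dual ℂ V →ₗ[ℂ] Module.Dual ℂ V :=
  Module.Dual.transpose (g⁻¹ : V ≃ₗ[ℂ] V).toLinearMap

@[simp] theorem dualAct_apply (g : V ≃ₗ[ℂ] V) (x : Module.Dual ℂ V) (u : V) :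
    dualAct g x u = x (g⁻¹ u) := rfl

theorem dualAct_one : dualAct (1 : V ≃ₗ[ℂ] V) = LinearMap.id := by
  ext x u; simp

theorem dualAct_mul (g h : V ≃ₗ[ℂ] V) : dualAct (g * h) = dualAct g ∘ₗ dualAct h := by
  ext x u; simp [mul_inv_rev]

/-- The action of `GL(V)` on `ℂ[V]` by algebra maps. -/
def polyAct (g : V ≃ₗ[ℂ] V) : PolyFun V →ₐ[ℂ] PolyFun V :=
  SymmetricAlgebra.lift (SymmetricAlgebra.ι ℂ (Module.Dual ℂ V) ∘ₗ dualAct g)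

@[simp] theorem polyAct_ι (g : V ≃ₗ[ℂ] V) (x : Module.Dual ℂ V) :
    polyAct g (SymmetricAlgebra.ι ℂ _ x) = SymmetricAlgebra.ι ℂ _ (dualAct g x) := by
  simp [polyAct]

theorem polyAct_one : polyAct (1 : V ≃ₗ[ℂ] V) = AlgHom.id ℂ (PolyFun V) := by
  apply SymmetricAlgebra.algHom_ext
  ext1 x
  simp [dualAct_one]

theorem polyAct_mul (g h : V ≃ₗ[ℂ] V) : polyAct (g * h) = (polyAct g).comp (polyAct h) := by
  apply SymmetricAlgebra.algHom_ext
  ext1 x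
  simp [dualAct_mul]

/-- The algebra map out of a symmetric algebra given by a linear map whose values commute pairwise,
the target being an arbitrary algebra. -/
def symLift {M A : Type*} [AddCommGroup M] [Module ℂ M] [Ring A] [Algebra ℂ A] (f : M →ₗ[ℂ] A)
    (hf : ∀ x x', f x * f x' = f x' * f x) : SymmetricAlgebra ℂ M →ₐ[ℂ] A :=
  let S := Algebra.adjoin ℂ (Set.range f)
  letI : CommSemiring S :=
    { (inferInstance : Semiring S) with
      mul_comm := (Algebra.isMulCommutative_adjoin ℂ
        (by rintro _ ⟨x, rfl⟩ _ ⟨x', rfl⟩; exact hf x x')).is_comm.comm }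
  let φ : SymmetricAlgebra ℂ M →ₐ[ℂ] S := SymmetricAlgebra.lift (R := ℂ) (M := M) (A := S)
    (f.codRestrict (Subalgebra.toSubmodule S) fun x => Algebra.subset_adjoin ⟨x, rfl⟩)
  S.val.comp φ

theorem symLift_ι {M A : Type*} [AddCommGroup M] [Module ℂ M] [Ring A] [Algebra ℂ A]
    (f : M →ₗ[ℂ] A) (hf : ∀ x x', f x * f x' = f x' * f x) (x : M) :
    symLift f hf (SymmetricAlgebra.ι ℂ M x) = f x := by
  let _ : CommSemiring (Algebra.adjoin ℂ (Set.range f)) :=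
    { (inferInstance : Semiring (Algebra.adjoin ℂ (Set.range f))) with
      mul_comm := (Algebra.isMulCommutative_adjoin ℂ
        (by rintro _ ⟨x, rfl⟩ _ ⟨x', rfl⟩; exact hf x x')).is_comm.comm }
  exact congrArg Subtype.val (SymmetricAlgebra.lift_ι_apply (R := ℂ) (M := M)
    (A := Algebra.adjoin ℂ (Set.range f)) _ x)

/-- The action of `GL(V)` on the tensor algebra `T(V ⊕ V*)` by algebra maps. -/
def tensorAct (g : V ≃ₗ[ℂ] V) :
    TensorAlgebra ℂ (V × Module.Dual ℂ V) →ₐ[ℂ] TensorAlgebra ℂ (V × Module.Dual ℂ V) :=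
  TensorAlgebra.lift ℂ (TensorAlgebra.ι ℂ ∘ₗ (g : V →ₗ[ℂ] V).prodMap (dualAct g))

@[simp] theorem tensorAct_ι (g : V ≃ₗ[ℂ] V) (u : V × Module.Dual ℂ V) :
    tensorAct g (TensorAlgebra.ι ℂ u) = TensorAlgebra.ι ℂ (g u.1, dualAct g u.2) := by
  simp [tensorAct]

theorem tensorAct_one :
    tensorAct (1 : V ≃ₗ[ℂ] V) = AlgHom.id ℂ (TensorAlgebra ℂ (V × Module.Dual ℂ V)) := by
  apply TensorAlgebra.hom_ext
  apply LinearMap.ext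
  intro u
  simp [dualAct_one]

theorem tensorAct_mul (g h : V ≃ₗ[ℂ] V) :
    tensorAct (g * h) = (tensorAct g).comp (tensorAct h) := by
  apply TensorAlgebra.hom_ext
  apply LinearMap.ext
  intro u
  simp [dualAct_mul]

instance tensorMulSemiringAction (G : Subgroup (V ≃ₗ[ℂ] V)) :
    MulSemiringAction G (TensorAlgebra ℂ (V × Module.Dual ℂ V)) where
  smul g a := tensorAct (g : V ≃ₗ[ℂ] V) a
  one_smul a := congrArg (fun f => f a) tensorAct_one
  mul_smul g h a := congrArg (fun f => f a) (tensorAct_mul (g : V ≃ₗ[ℂ] V) h)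
  smul_zero g := map_zero (tensorAct (g : V ≃ₗ[ℂ] V))
  smul_add g := map_add (tensorAct (g : V ≃ₗ[ℂ] V))
  smul_one g := map_one (tensorAct (g : V ≃ₗ[ℂ] V))
  smul_mul g := map_mul (tensorAct (g : V ≃ₗ[ℂ] V))

instance tensorSMulCommClass (G : Subgroup (V ≃ₗ[ℂ] V)) :
    SMulCommClass G ℂ (TensorAlgebra ℂ (V × Module.Dual ℂ V)) where
  smul_comm g c a := map_smul (tensorAct (g : V ≃ₗ[ℂ] V)) c a

end Polynomials

/-! ### The setting -/

/-- The normaliser of `W₀` in `W`. -/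
def normalizerIn {V : Type*} [AddCommGroup V] [Module ℂ V] (W W₀ : Subgroup (V ≃ₗ[ℂ] V)) :
    Subgroup (V ≃ₗ[ℂ] V) :=
  W ⊓ Subgroup.normalizer (W₀ : Set (V ≃ₗ[ℂ] V))

/-- The pointwise stabiliser in `G` of a subspace `H`. -/
def pointwiseStab {V : Type*} [AddCommGroup V] [Module ℂ V] (G : Subgroup (V ≃ₗ[ℂ] V))
    (H : Submodule ℂ V) : Subgroup G where
  carrier := {w | ∀ u ∈ H, (w : V ≃ₗ[ℂ] V) u = u}
  one_mem' := fun _ _ => rfl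
  mul_mem' := by
    intro a b ha hb u hu
    have := hb u hu
    simp only [Subgroup.coe_mul, LinearEquiv.mul_apply, this, ha u hu]
  inv_mem' := by
    intro a ha u hu
    have h := ha u hu
    apply (a : V ≃ₗ[ℂ] V).injective
    rw [h]
    exact (a : V ≃ₗ[ℂ] V).apply_symm_apply u

/-- A finite complex reflection group `W` on `V`, a reflection subgroup `W₀`, linear forms `α H`
and vectors `v H` attached to the reflecting hyperplanes, and parameters `k H j`. -/
structure ReflectionPair (V : Type*) [AddCommGroup V] [Module ℂ V] where
  /-- the finite complex reflection group -/
  W : Subgroup (V ≃ₗ[ℂ] V)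
  finite_W : Finite W
  isReflectionGroup_W : IsReflectionGroup W
  /-- the reflection subgroup -/
  W₀ : Subgroup (V ≃ₗ[ℂ] V)
  W₀_le : W₀ ≤ W
  isReflectionGroup_W₀ : IsReflectionGroup W₀
  /-- linear forms defining the reflecting hyperplanes of `W` -/
  α : Submodule ℂ V → Module.Dual ℂ V
  ker_α : ∀ H ∈ arrangement W, LinearMap.ker (α H) = H
  /-- vectors spanning the stable complements of the reflecting hyperplanes of `W₀` -/
  v : Submodule ℂ V → V
  isCompl_v : ∀ H ∈ arrangement W₀, IsCompl (Submodule.span ℂ {v H}) H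
  v_stable : ∀ H ∈ arrangement W₀, ∀ w ∈ pointwiseStab W H,
    (w : V ≃ₗ[ℂ] V) (v H) ∈ Submodule.span ℂ {v H}
  /-- the parameters `k H j`; only those with `H` a reflecting hyperplane of `W₀` and
  `j < m_H`, the order of the pointwise stabiliser of `H` in `N_W(W₀)`, are used -/
  k : Submodule ℂ V → ℕ → ℂ
  k_map : ∀ g ∈ normalizerIn W W₀, ∀ H ∈ arrangement W₀,
    ∀ j < Nat.card (pointwiseStab (normalizerIn W W₀) H),
      k (H.map (g : V →ₗ[ℂ] V)) j = k H j

namespace ReflectionPair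

variable {V : Type*} [AddCommGroup V] [Module ℂ V] (D : ReflectionPair V)

instance : Finite D.W := D.finite_W

instance : Finite D.W₀ := Finite.of_injective _ (Subgroup.inclusion_injective D.W₀_le)

/-- The group `N = N_W(W₀)`. -/
abbrev N : Subgroup (V ≃ₗ[ℂ] V) := normalizerIn D.W D.W₀

theorem N_le : D.N ≤ D.W := inf_le_left

instance : Finite D.N := Finite.of_injective _ (Subgroup.inclusion_injective D.N_le)

/-- The reflecting hyperplanes of `W`. -/
def hyperplanes : Finset (Submodule ℂ V) := (arrangement_finite D.W).toFinset

/-- The reflecting hyperplanes of `W₀`. -/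
def hyperplanes₀ : Finset (Submodule ℂ V) := (arrangement_finite D.W₀).toFinset

theorem mem_hyperplanes {H : Submodule ℂ V} : H ∈ D.hyperplanes ↔ H ∈ arrangement D.W := by
  simp [hyperplanes]

/-- The pointwise stabiliser of `H` in `N`. -/
abbrev stab (H : Submodule ℂ V) : Subgroup D.N := pointwiseStab D.N H

instance (H : Submodule ℂ V) : Fintype (D.stab H) := Fintype.ofFinite _

/-- The order `m_H` of the pointwise stabiliser of `H`. -/
def m (H : Submodule ℂ V) : ℕ := Nat.card (D.stab H)

/-- The idempotents `ε_{H,j} = (1 / m_H) ∑ det(w)^j w`, the sum being over the pointwise stabiliser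
of `H`. -/
def ε (H : Submodule ℂ V) (j : ℕ) : MonoidAlgebra ℂ D.N :=
  (D.m H : ℂ)⁻¹ • ∑ w : D.stab H,
    (LinearMap.det ((w : D.N) : V ≃ₗ[ℂ] V).toLinearMap) ^ j • MonoidAlgebra.of ℂ D.N (w : D.N)

/-- `γ_H = ∑_j m_H (k_{H,j+1} - k_{H,j}) ε_{H,j}`, the index `j` of `k` being read modulo `m_H`. -/
def γ (H : Submodule ℂ V) : MonoidAlgebra ℂ D.N :=
  ∑ j ∈ Finset.range (D.m H),
    ((D.m H : ℂ) * (D.k H ((j + 1) % D.m H) - D.k H j)) • D.ε H j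

/-- `a_H = ∑_j m_H k_{H,j} ε_{H,j}`. -/
def a (H : Submodule ℂ V) : MonoidAlgebra ℂ D.N :=
  ∑ j ∈ Finset.range (D.m H), ((D.m H : ℂ) * D.k H j) • D.ε H j

/-! ### The Cherednik algebra -/

/-- The skew group algebra `T(V ⊕ V*) ⋊ N`. -/
abbrev TensorSkew := SkewMonoidAlgebra (TensorAlgebra ℂ (V × Module.Dual ℂ V)) D.N

/-- `y ∈ V` as an element of `T(V ⊕ V*) ⋊ N`. -/
def tensY (y : V) : D.TensorSkew :=
  SkewMonoidAlgebra.single 1 (TensorAlgebra.ι ℂ (y, (0 : Module.Dual ℂ V)))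

/-- `x ∈ V*` as an element of `T(V ⊕ V*) ⋊ N`. -/
def tensX (x : Module.Dual ℂ V) : D.TensorSkew :=
  SkewMonoidAlgebra.single 1 (TensorAlgebra.ι ℂ ((0 : V), x))

/-- `ℂN` inside `T(V ⊕ V*) ⋊ N`. -/
def tensGroup : MonoidAlgebra ℂ D.N →ₐ[ℂ] D.TensorSkew :=
  MonoidAlgebra.lift ℂ D.TensorSkew D.N (SkewMonoidAlgebra.of _ _)

/-- The defining relations of the rational Cherednik algebra `A(W₀, W)`. -/
inductive Rel : D.TensorSkew → D.TensorSkew → Prop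
  | xx (x x' : Module.Dual ℂ V) : Rel (D.tensX x * D.tensX x' - D.tensX x' * D.tensX x) 0
  | yy (y y' : V) : Rel (D.tensY y * D.tensY y' - D.tensY y' * D.tensY y) 0
  | yx (y : V) (x : Module.Dual ℂ V) : Rel (D.tensY y * D.tensX x - D.tensX x * D.tensY y)
      (algebraMap ℂ D.TensorSkew (x y) + ∑ H ∈ D.hyperplanes₀,
        (D.α H y * x (D.v H) / D.α H (D.v H)) • D.tensGroup (D.γ H))

/-- The rational Cherednik algebra `A(W₀, W)` of the normaliser (with `t = 1`). -/
def Cherednik := RingQuot D.Rel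

instance : Ring D.Cherednik := inferInstanceAs (Ring (RingQuot D.Rel))

instance : Algebra ℂ D.Cherednik := inferInstanceAs (Algebra ℂ (RingQuot D.Rel))

/-- The projection of `T(V ⊕ V*) ⋊ N` onto `A(W₀, W)`. -/
def toCherednik : D.TensorSkew →ₐ[ℂ] D.Cherednik := RingQuot.mkAlgHom ℂ D.Rel

/-- The generators `y ∈ V` of `A(W₀, W)`. -/
def genY (y : V) : D.Cherednik := D.toCherednik (D.tensY y)

/-- The generators `x ∈ V*` of `A(W₀, W)`. -/
def genX (x : Module.Dual ℂ V) : D.Cherednik := D.toCherednik (D.tensX x)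

/-- The generators `w ∈ N` of `A(W₀, W)`. -/
def genN (w : D.N) : D.Cherednik := D.toCherednik (SkewMonoidAlgebra.of _ _ w)

theorem genX_comm (x x' : Module.Dual ℂ V) : D.genX x * D.genX x' = D.genX x' * D.genX x := by
  have h := RingQuot.mkAlgHom_rel ℂ (Rel.xx (D := D) x x')
  rw [map_sub, map_mul, map_mul, map_zero, sub_eq_zero] at h
  exact h

/-- `genX` as a linear map. -/
def genXLinear : Module.Dual ℂ V →ₗ[ℂ] D.Cherednik where
  toFun := D.genX
  map_add' x x' := by
    have h : ((0 : V), x + x') = ((0 : V), x) + ((0 : V), x') := by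
      rw [Prod.mk_add_mk, add_zero]
    unfold genX tensX
    rw [h, map_add, SkewMonoidAlgebra.single_add, map_add]
  map_smul' c x := by
    have h : ((0 : V), c • x) = c • ((0 : V), x) := by
      rw [Prod.smul_mk, smul_zero]
    unfold genX tensX
    rw [h, map_smul, ← SkewMonoidAlgebra.smul_single, map_smul, RingHom.id_apply]

/-- The algebra map `ℂ[V] → A(W₀, W)` extending `x ↦ x` on `V*`. -/
def polyToCherednik : PolyFun V →ₐ[ℂ] D.Cherednik := symLift D.genXLinear D.genX_comm

theorem polyToCherednik_ι (x : Module.Dual ℂ V) :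
    D.polyToCherednik (SymmetricAlgebra.ι ℂ _ x) = D.genX x := symLift_ι _ _ x

/-- `A(W₀, W)` as a left `ℂ[V]`-module. -/
instance : Module (PolyFun V) D.Cherednik :=
  Module.compHom D.Cherednik D.polyToCherednik.toRingHom

/-! ### The complement `X` of the hyperplanes and its differential operators -/

/-- `δ = ∏ α_H`, the product being over all the reflecting hyperplanes of `W`. -/
def δ : PolyFun V := ∏ H ∈ D.hyperplanes, SymmetricAlgebra.ι ℂ _ (D.α H)

/-- The coordinate ring `ℂ[X] = ℂ[V][1/δ]` of the complement `X` of the hyperplanes of `W`. -/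
def CX := Localization.Away D.δ

instance : CommRing D.CX := inferInstanceAs (CommRing (Localization.Away D.δ))

instance : Algebra (PolyFun V) D.CX :=
  inferInstanceAs (Algebra (PolyFun V) (Localization.Away D.δ))

instance : Algebra ℂ D.CX := inferInstanceAs (Algebra ℂ (Localization.Away D.δ))

instance : IsScalarTower ℂ (PolyFun V) D.CX :=
  inferInstanceAs (IsScalarTower ℂ (PolyFun V) (Localization.Away D.δ))

instance : IsLocalization.Away D.δ D.CX :=
  inferInstanceAs (IsLocalization.Away D.δ (Localization.Away D.δ))

/-- The image in `ℂ[X]` of a linear form. -/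
def coord (x : Module.Dual ℂ V) : D.CX :=
  algebraMap (PolyFun V) D.CX (SymmetricAlgebra.ι ℂ _ x)

theorem isUnit_coord_α {H : Submodule ℂ V} (hH : H ∈ arrangement D.W) :
    IsUnit (D.coord (D.α H)) := by
  have h1 : IsUnit (algebraMap (PolyFun V) D.CX D.δ) := IsLocalization.Away.algebraMap_isUnit D.δ
  refine isUnit_of_dvd_unit ?_ h1
  obtain ⟨q, hq⟩ : SymmetricAlgebra.ι ℂ _ (D.α H) ∣ D.δ :=
    Finset.dvd_prod_of_mem (fun H => SymmetricAlgebra.ι ℂ _ (D.α H)) (D.mem_hyperplanes.2 hH)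
  exact ⟨algebraMap (PolyFun V) D.CX q,
    (congrArg (algebraMap (PolyFun V) D.CX) hq).trans (RingHom.map_mul _ _ _)⟩

theorem exists_dualAct_α {g : V ≃ₗ[ℂ] V} (hg : g ∈ D.W) {H : Submodule ℂ V}
    (hH : H ∈ arrangement D.W) :
    ∃ c : ℂ, c ≠ 0 ∧ dualAct g (D.α H) = c • D.α (H.map (g : V →ₗ[ℂ] V)) := by
  have h1 := D.ker_α _ (map_mem_arrangement hg hH)
  have h2 : LinearMap.ker (dualAct g (D.α H)) = H.map (g : V →ₗ[ℂ] V) := by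
    ext u
    rw [LinearMap.mem_ker, dualAct_apply, ← LinearMap.mem_ker, D.ker_α _ hH, Submodule.mem_map]
    constructor
    · intro h
      exact ⟨_, h, g.apply_symm_apply u⟩
    · rintro ⟨t, ht, rfl⟩
      have : g⁻¹ (g t) = t := g.symm_apply_apply t
      simpa [this] using ht
  have hle : dualAct g (D.α H) ∈
      Submodule.span ℂ (Set.range fun _ : Unit => D.α (H.map (g : V →ₗ[ℂ] V))) := by
    apply mem_span_of_iInf_ker_le_ker
    rw [iInf_const, h1, h2]
  obtain ⟨c, hc⟩ : ∃ c : ℂ, c • D.α (H.map (g : V →ₗ[ℂ] V)) = dualAct g (D.α H) := by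
    rw [Set.range_const] at hle
    exact Submodule.mem_span_singleton.1 hle
  refine ⟨c, ?_, hc.symm⟩
  rintro rfl
  rw [zero_smul] at hc
  rw [← hc, LinearMap.ker_zero] at h2
  obtain ⟨s, -, hs, hs'⟩ := map_mem_arrangement hg hH
  unfold IsReflection at hs
  rw [hs', ← h2, finrank_top] at hs
  omega

theorem isUnit_polyAct_δ {g : V ≃ₗ[ℂ] V} (hg : g ∈ D.W) :
    IsUnit (algebraMap (PolyFun V) D.CX (polyAct g D.δ)) := by
  have h0 : polyAct g D.δ =
      ∏ H ∈ D.hyperplanes, polyAct g (SymmetricAlgebra.ι ℂ _ (D.α H)) := map_prod _ _ _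
  have h1 : algebraMap (PolyFun V) D.CX (polyAct g D.δ) = ∏ H ∈ D.hyperplanes,
      algebraMap (PolyFun V) D.CX (polyAct g (SymmetricAlgebra.ι ℂ _ (D.α H))) :=
    (congrArg (algebraMap (PolyFun V) D.CX) h0).trans
      (map_prod (algebraMap (PolyFun V) D.CX) _ _)
  rw [h1]
  refine Finset.prod_induction _ _ (fun _ _ => IsUnit.mul) isUnit_one ?_
  intro H hH
  have hH' := D.mem_hyperplanes.1 hH
  obtain ⟨c, hc, h⟩ := D.exists_dualAct_α hg hH'
  rw [polyAct_ι, h, map_smul, Algebra.smul_def, RingHom.map_mul]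
  refine IsUnit.mul ?_ (D.isUnit_coord_α (map_mem_arrangement hg hH'))
  exact ((IsUnit.mk0 c hc).map (algebraMap ℂ (PolyFun V))).map (algebraMap (PolyFun V) D.CX)

/-- The action on `ℂ[X]` of an element of `W`, extending the action on `ℂ[V]`. -/
def actHom (g : D.N) : D.CX →ₐ[ℂ] D.CX :=
  IsLocalization.Away.liftAlgHom D.δ
    (f := (IsScalarTower.toAlgHom ℂ (PolyFun V) D.CX).comp (polyAct (g : V ≃ₗ[ℂ] V)))
    (D.isUnit_polyAct_δ (D.N_le g.2))

theorem actHom_algebraMap (g : D.N) (p : PolyFun V) :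
    D.actHom g (algebraMap (PolyFun V) D.CX p) =
      algebraMap (PolyFun V) D.CX (polyAct (g : V ≃ₗ[ℂ] V) p) :=
  IsLocalization.Away.lift_eq D.δ (D.isUnit_polyAct_δ (D.N_le g.2)) p

theorem CX_algHom_ext {A : Type*} [Semiring A] [Algebra ℂ A] {f g : D.CX →ₐ[ℂ] A}
    (h : ∀ p, f (algebraMap (PolyFun V) D.CX p) = g (algebraMap (PolyFun V) D.CX p)) : f = g := by
  apply AlgHom.coe_ringHom_injective
  apply IsLocalization.ringHom_ext (Submonoid.powers D.δ)
  exact RingHom.ext h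

theorem actHom_one : D.actHom 1 = AlgHom.id ℂ D.CX := by
  apply D.CX_algHom_ext
  intro p
  rw [actHom_algebraMap, Subgroup.coe_one, polyAct_one]
  rfl

theorem actHom_mul (g h : D.N) : D.actHom (g * h) = (D.actHom g).comp (D.actHom h) := by
  apply D.CX_algHom_ext
  intro p
  rw [AlgHom.comp_apply, actHom_algebraMap, actHom_algebraMap, actHom_algebraMap,
    Subgroup.coe_mul, polyAct_mul]
  rfl

/-- The action of `N` on `ℂ[X]` by algebra automorphisms: `(g f)(u) = f (g⁻¹ u)`. -/
def act (g : D.N) : D.CX ≃ₐ[ℂ] D.CX :=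
  AlgEquiv.ofAlgHom (D.actHom g) (D.actHom g⁻¹)
    (by rw [← actHom_mul, mul_inv_cancel, actHom_one])
    (by rw [← actHom_mul, inv_mul_cancel, actHom_one])

theorem act_one : D.act 1 = AlgEquiv.refl := by
  ext f
  exact congrArg (fun φ => φ f) D.actHom_one

theorem act_mul (g h : D.N) : D.act (g * h) = (D.act h).trans (D.act g) := by
  ext f
  exact congrArg (fun φ => φ f) (D.actHom_mul g h)

/-- The algebra `𝒟(X)` of differential operators on `X`. -/
abbrev DX := diffOps D.CX

/-- `N` acts on `𝒟(X)` by `g θ = g ∘ θ ∘ g⁻¹`. -/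
instance : MulSemiringAction D.N D.DX where
  smul g θ := diffOpsConj (D.act g) θ
  one_smul θ := by
    apply Subtype.ext
    apply LinearMap.ext
    intro f
    change D.act 1 (θ.1 ((D.act 1).symm f)) = θ.1 f
    rw [act_one]
    rfl
  mul_smul g h θ := by
    apply Subtype.ext
    apply LinearMap.ext
    intro f
    change D.act (g * h) (θ.1 ((D.act (g * h)).symm f)) =
      D.act g (D.act h (θ.1 ((D.act h).symm ((D.act g).symm f))))
    rw [act_mul]
    rfl
  smul_zero g := map_zero (diffOpsConj (D.act g))
  smul_add g := map_add (diffOpsConj (D.act g))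
  smul_one g := map_one (diffOpsConj (D.act g))
  smul_mul g := map_mul (diffOpsConj (D.act g))

instance : SMulCommClass D.N ℂ D.DX where
  smul_comm g c θ := map_smul (diffOpsConj (D.act g)) c θ

/-- The skew group algebra `𝒟(X) ⋊ N`. -/
abbrev DXSkew := SkewMonoidAlgebra D.DX D.N

/-- `ℂ[X]` inside `𝒟(X) ⋊ N`, as multiplication operators. -/
def fn (f : D.CX) : D.DXSkew := SkewMonoidAlgebra.single 1 (functionOp D.CX f)

/-- `ℂN` inside `𝒟(X) ⋊ N`. -/
def groupToDXSkew : MonoidAlgebra ℂ D.N →ₐ[ℂ] D.DXSkew :=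
  MonoidAlgebra.lift ℂ D.DXSkew D.N (SkewMonoidAlgebra.of _ _)

/-- The algebra map from `ℂ[V]` to the dual numbers `ℂ[X][e]`, `e² = 0`, that sends `x ∈ V*` to
`x + x(y) e`. -/
def dualNumbersPoly (y : V) : PolyFun V →ₐ[ℂ] DualNumber D.CX :=
  SymmetricAlgebra.lift
    { toFun := fun x => TrivSqZeroExt.inl (D.coord x) + TrivSqZeroExt.inr (algebraMap ℂ D.CX (x y))
      map_add' := fun x x' => by
        apply TrivSqZeroExt.ext
        · simp [coord]
        · simp only [LinearMap.add_apply, map_add, TrivSqZeroExt.snd_add, TrivSqZeroExt.snd_inl,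
            TrivSqZeroExt.snd_inr, zero_add]
      map_smul' := fun c x => by
        have h : D.coord (c • x) = c • D.coord x := by
          unfold coord
          rw [map_smul, Algebra.smul_def, Algebra.smul_def, RingHom.map_mul,
            IsScalarTower.algebraMap_apply ℂ (PolyFun V) D.CX]
        apply TrivSqZeroExt.ext
        · simp only [h, RingHom.id_apply, TrivSqZeroExt.fst_add, TrivSqZeroExt.fst_inl,
            TrivSqZeroExt.fst_inr, TrivSqZeroExt.fst_smul, add_zero]
        · simp only [RingHom.id_apply, TrivSqZeroExt.snd_add, TrivSqZeroExt.snd_inl,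
            TrivSqZeroExt.snd_inr, TrivSqZeroExt.snd_smul, zero_add, LinearMap.smul_apply,
            smul_eq_mul, map_mul]
          exact (Algebra.smul_def c _).symm }

theorem fst_dualNumbersPoly (y : V) (p : PolyFun V) :
    (D.dualNumbersPoly y p).fst = algebraMap (PolyFun V) D.CX p := by
  have : (TrivSqZeroExt.fstHom ℂ D.CX D.CX).comp (D.dualNumbersPoly y) =
      IsScalarTower.toAlgHom ℂ (PolyFun V) D.CX := by
    apply SymmetricAlgebra.algHom_ext
    ext1 x
    simp [dualNumbersPoly, coord]
  exact congrArg (fun φ => φ p) this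

theorem isUnit_dualNumbersPoly_δ (y : V) : IsUnit (D.dualNumbersPoly y D.δ) := by
  rw [TrivSqZeroExt.isUnit_iff_isUnit_fst, fst_dualNumbersPoly]
  exact IsLocalization.Away.algebraMap_isUnit D.δ

/-- The extension of `dualNumbersPoly` to `ℂ[X]`; it sends `f` to `f + (∂_y f) e`. -/
def dualNumbersMap (y : V) : D.CX →ₐ[ℂ] DualNumber D.CX :=
  IsLocalization.Away.liftAlgHom D.δ (f := D.dualNumbersPoly y) (D.isUnit_dualNumbersPoly_δ y)

theorem dualNumbersMap_algebraMap (y : V) (p : PolyFun V) :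
    D.dualNumbersMap y (algebraMap (PolyFun V) D.CX p) = D.dualNumbersPoly y p :=
  IsLocalization.Away.lift_eq D.δ (D.isUnit_dualNumbersPoly_δ y) p

theorem fst_dualNumbersMap (y : V) (f : D.CX) : (D.dualNumbersMap y f).fst = f := by
  have : (TrivSqZeroExt.fstHom ℂ D.CX D.CX).comp (D.dualNumbersMap y) = AlgHom.id ℂ D.CX := by
    apply D.CX_algHom_ext
    intro p
    rw [AlgHom.comp_apply, dualNumbersMap_algebraMap]
    exact D.fst_dualNumbersPoly y p
  exact congrArg (fun φ => φ f) this

/-- The directional derivative `∂_y` on `ℂ[X]`: the derivation with `∂_y x = x(y)` for `x ∈ V*`. -/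
def partialDeriv (y : V) : Derivation ℂ D.CX D.CX :=
  Derivation.mk'
    { toFun := fun f => (D.dualNumbersMap y f).snd
      map_add' := fun f g => by rw [map_add]; rfl
      map_smul' := fun c f => by rw [map_smul]; rfl }
    (fun f g => by
      simp only [LinearMap.coe_mk, AddHom.coe_mk, map_mul, TrivSqZeroExt.snd_mul,
        fst_dualNumbersMap, op_smul_eq_smul, smul_eq_mul])

theorem partialDeriv_coord (y : V) (x : Module.Dual ℂ V) :
    D.partialDeriv y (D.coord x) = algebraMap ℂ D.CX (x y) := by
  change (D.dualNumbersMap y (D.coord x)).snd = _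
  rw [coord, dualNumbersMap_algebraMap]
  simp only [dualNumbersPoly, SymmetricAlgebra.lift_ι_apply, LinearMap.coe_mk, AddHom.coe_mk,
    TrivSqZeroExt.snd_add, TrivSqZeroExt.snd_inl, TrivSqZeroExt.snd_inr, zero_add]

/-- The Dunkl operator `T_y = ∂_y + ∑ (α_H(y) / α_H) a_H`, the sum being over the reflecting
hyperplanes of `W₀`.  (The elements `α_H` of `ℂ[X]` are invertible.) -/
def dunkl (y : V) : D.DXSkew :=
  SkewMonoidAlgebra.single 1 (derivationOp (D.partialDeriv y)) +
    ∑ H ∈ D.hyperplanes₀, D.α H y •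
      (D.fn (Ring.inverse (D.coord (D.α H))) * D.groupToDXSkew (D.a H))

end ReflectionPair

end

noncomputable section

/-! Existence of `Φ`. An element w of N_H fixes H and scales v_H by det(w), so wy - y is a multiple
of α_H(y) v_H and wx - x is a multiple of x(v_H) α_H. The second fact, with a cyclic shift of the
index j, turns the commutator of a_H with x into α_H γ_H up to a scalar. The factor α_H cancels the
pole of T_y and leaves the relation for [y, x] (`dunkl_mul_coord`). Equivariance is `gp_mul_dunkl`.

The remaining relation is that C = [T_y, T_y'] vanishes. By the Jacobi identity [C, x] is the
difference of [T_y, [T_y', x]] and [T_y', [T_y, x]]. Since [T_y, γ_H] is α_H(y) times an element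
independent of y, both are the same sum with coefficients α_H(y) α_H(y'), so C commutes with ℂ[X].
As N acts faithfully and ℂ[X] is a domain, the commutant of ℂ[X] in 𝒟(X) ⋊ N is ℂ[X] itself
(`eq_fnHom_of_commute`). So C is the function obtained by applying C to 1, and this is 0 because
T_y(T_y'(1)) is visibly symmetric in y and y' (`rep_dunkl_dunklOne`).

Injectivity. Reordering with the relations writes each element of A(W₀, W) as a sum of terms p(x)
y^β w (`exists_eq_sum_leftEval`). Since T_y is ∂_y plus terms of order 0, the top-order part of p
T^β w is p ∂^β w, and the ∂^β w are independent over ℂ[X]. So the T^β w are independent as well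
(`eq_zero_of_sum_leftEval`), which gives injectivity.

Localization. δ is semi-invariant under N, and [y, p] lies in the subalgebra generated by V* and N.
Hence powers of δ pass across V* and N at no cost and across y at the cost of one power, which is
the Ore condition (`exists_genδ_pow_mul`). Since `Φ` is injective and sends δ to a unit, it extends
injectively to the localization. The image contains ℂ[X], N and therefore each ∂_y = T_y - (terms in
ℂ[X] and ℂN). These generate everything, because an Euler-type identity reduces an operator on X to
functions and derivatives (`subalgebra_DX_eq_top`). Finally every tensor in ℂ[X] ⊗ A(W₀, W) has the
form δ^{-n} ⊗ a, which identifies the tensor product with the localization. -/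

/-- The derivation `σ⁻¹ ∘ d ∘ σ`. -/
def conjDerivation {R : Type*} [CommRing R] [Algebra ℂ R] (σ : R ≃ₐ[ℂ] R) (d : Derivation ℂ R R) :
    Derivation ℂ R R :=
  Derivation.mk' (σ.symm.toLinearMap ∘ₗ d.toLinearMap ∘ₗ σ.toLinearMap) (fun a b => by simp)

theorem conjDerivation_apply {R : Type*} [CommRing R] [Algebra ℂ R] (σ : R ≃ₐ[ℂ] R)
    (d : Derivation ℂ R R) (f : R) : conjDerivation σ d f = σ.symm (d (σ f)) := rfl

namespace ReflectionPair

variable {V : Type*} [AddCommGroup V] [Module ℂ V] (D : ReflectionPair V)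

/-! ### Functions and derivations on the complement of the hyperplanes -/

theorem coord_add (x x' : Module.Dual ℂ V) : D.coord (x + x') = D.coord x + D.coord x' := by
  simp only [coord, map_add]

theorem coord_smul (c : ℂ) (x : Module.Dual ℂ V) : D.coord (c • x) = c • D.coord x := by
  unfold coord
  rw [map_smul, Algebra.smul_def, Algebra.smul_def, RingHom.map_mul,
    IsScalarTower.algebraMap_apply ℂ (PolyFun V) D.CX]

theorem algebraMap_mem_of_coord_mem (S : Subalgebra ℂ D.CX) (hS : ∀ x, D.coord x ∈ S)
    (p : PolyFun V) : algebraMap (PolyFun V) D.CX p ∈ S := by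
  induction p using SymmetricAlgebra.induction with
  | algebraMap c =>
    rw [← IsScalarTower.algebraMap_apply ℂ (PolyFun V) D.CX]
    exact S.algebraMap_mem c
  | ι x => exact hS x
  | mul p q hp hq => rw [RingHom.map_mul]; exact S.mul_mem hp hq
  | add p q hp hq => rw [RingHom.map_add]; exact S.add_mem hp hq

/-- Every f in ℂ[X] becomes polynomial after multiplication by some δ^n, and the factors δ are
removed one at a time. The divisibility hypothesis replaces δ⁻¹ ∈ S because it is what cancellation
of a unit gives for equalisers and centralisers. -/
theorem subalgebra_CX_eq_top (S : Subalgebra ℂ D.CX) (hS : ∀ x, D.coord x ∈ S)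
    (hδ : ∀ f, f * algebraMap (PolyFun V) D.CX D.δ ∈ S → f ∈ S) : S = ⊤ := by
  refine Algebra.eq_top_iff.2 fun f => ?_
  obtain ⟨n, p, h⟩ := IsLocalization.Away.surj D.δ f
  have hmem : ∀ (n : ℕ) (g : D.CX), g * algebraMap (PolyFun V) D.CX D.δ ^ n ∈ S → g ∈ S := by
    intro n
    induction n with
    | zero => intro g hg; simpa using hg
    | succ n ih => intro g hg; exact ih g (hδ _ (by rwa [mul_assoc, ← pow_succ]))
  exact hmem n f (h ▸ D.algebraMap_mem_of_coord_mem S hS p)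

theorem isUnit_algebraMap_δ : IsUnit (algebraMap (PolyFun V) D.CX D.δ) :=
  IsLocalization.Away.algebraMap_isUnit D.δ

theorem derivation_ext {d d' : Derivation ℂ D.CX D.CX}
    (h : ∀ x, d (D.coord x) = d' (D.coord x)) : d = d' := by
  let S : Subalgebra ℂ D.CX :=
    { carrier := {f | d f = d' f}
      mul_mem' := fun {a b} ha hb => by
        change d a = d' a at ha
        change d b = d' b at hb
        change d (a * b) = d' (a * b)
        rw [d.leibniz, d'.leibniz, ha, hb]
      add_mem' := fun {a b} ha hb => by
        change d a = d' a at ha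
        change d b = d' b at hb
        change d (a + b) = d' (a + b)
        rw [map_add, map_add, ha, hb]
      algebraMap_mem' := fun c => by simp }
  have hS : S = ⊤ := D.subalgebra_CX_eq_top S h fun f hf => by
    have h1 : d (algebraMap (PolyFun V) D.CX D.δ) = d' (algebraMap (PolyFun V) D.CX D.δ) :=
      D.algebraMap_mem_of_coord_mem S h D.δ
    have h2 : d (f * algebraMap (PolyFun V) D.CX D.δ) =
      d' (f * algebraMap (PolyFun V) D.CX D.δ) := hf
    rw [d.leibniz, d'.leibniz, h1, smul_eq_mul, smul_eq_mul, smul_eq_mul] at h2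
    exact D.isUnit_algebraMap_δ.mul_left_cancel (add_left_cancel h2)
  ext f
  have : f ∈ S := hS ▸ Algebra.mem_top
  exact this

theorem partialDeriv_add (y y' : V) :
    D.partialDeriv (y + y') = D.partialDeriv y + D.partialDeriv y' := by
  apply D.derivation_ext
  intro x
  rw [Derivation.add_apply, partialDeriv_coord, partialDeriv_coord, partialDeriv_coord, map_add,
    map_add]

theorem partialDeriv_smul (c : ℂ) (y : V) : D.partialDeriv (c • y) = c • D.partialDeriv y := by
  apply D.derivation_ext
  intro x
  rw [Derivation.smul_apply, partialDeriv_coord, partialDeriv_coord, map_smul, smul_eq_mul,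
    map_mul, Algebra.smul_def]

/-- The commutator of two derivations is a derivation, and it kills the coordinates because ∂_y' x
is a constant. -/
theorem partialDeriv_comm (y y' : V) (f : D.CX) :
    D.partialDeriv y (D.partialDeriv y' f) = D.partialDeriv y' (D.partialDeriv y f) := by
  have h : ⁅D.partialDeriv y, D.partialDeriv y'⁆ = 0 := by
    apply D.derivation_ext
    intro x
    rw [Derivation.commutator_apply, partialDeriv_coord, partialDeriv_coord,
      Derivation.map_algebraMap, Derivation.map_algebraMap, sub_zero, Derivation.zero_apply]
  have h' := congrArg (fun d => d f) h
  simp only [Derivation.commutator_apply, Derivation.zero_apply] at h'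
  exact sub_eq_zero.1 h'

theorem act_coord (w : D.N) (x : Module.Dual ℂ V) :
    D.act w (D.coord x) = D.coord (dualAct (w : V ≃ₗ[ℂ] V) x) := by
  change D.actHom w (D.coord x) = _
  rw [coord, actHom_algebraMap, polyAct_ι]
  rfl

theorem act_symm (w : D.N) : (D.act w).symm = D.act w⁻¹ := by
  ext f
  rfl

/-- Both ∂_y and w⁻¹ ∂_{wy} w are derivations, so it suffices to compare them on linear forms, where
(wx)(wy) = x(y). -/
theorem act_partialDeriv (w : D.N) (y : V) (f : D.CX) :
    D.act w (D.partialDeriv y f) = D.partialDeriv ((w : V ≃ₗ[ℂ] V) y) (D.act w f) := by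
  have hd : D.partialDeriv y =
      conjDerivation (D.act w) (D.partialDeriv ((w : V ≃ₗ[ℂ] V) y)) := by
    apply D.derivation_ext
    intro x
    rw [conjDerivation_apply, act_coord, partialDeriv_coord, partialDeriv_coord, dualAct_apply,
      AlgEquiv.commutes]
    exact congrArg (fun u => algebraMap ℂ D.CX (x u))
      ((w : V ≃ₗ[ℂ] V).symm_apply_apply y).symm
  rw [hd, conjDerivation_apply, AlgEquiv.apply_symm_apply]

/-! ### The algebra `𝒟(X) ⋊ N` -/

/-- `𝒟(X)` inside `𝒟(X) ⋊ N`. -/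
def opHom : D.DX →ₐ[ℂ] D.DXSkew where
  toFun := SkewMonoidAlgebra.single 1
  map_one' := rfl
  map_mul' θ η := by rw [SkewMonoidAlgebra.single_mul_single, mul_one, one_smul]
  map_zero' := SkewMonoidAlgebra.single_zero _
  map_add' := SkewMonoidAlgebra.single_add _
  commutes' c := rfl

/-- `ℂ[X]` inside `𝒟(X) ⋊ N`, as an algebra map. -/
def fnHom : D.CX →ₐ[ℂ] D.DXSkew := D.opHom.comp (functionOp D.CX)

/-- `N` inside `𝒟(X) ⋊ N`. -/
abbrev gp : D.N →* D.DXSkew := SkewMonoidAlgebra.of D.DX D.N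

theorem coeff_opHom_mul_gp (θ : D.DX) (w : D.N) :
    D.opHom θ * D.gp w = SkewMonoidAlgebra.single w θ := by
  change SkewMonoidAlgebra.single 1 θ * SkewMonoidAlgebra.single w 1 = _
  rw [SkewMonoidAlgebra.single_mul_single, one_mul, one_smul, mul_one]

theorem gp_mul_opHom (w : D.N) (θ : D.DX) : D.gp w * D.opHom θ = D.opHom (w • θ) * D.gp w := by
  rw [coeff_opHom_mul_gp]
  change SkewMonoidAlgebra.single w 1 * SkewMonoidAlgebra.single 1 θ = _
  rw [SkewMonoidAlgebra.single_mul_single, one_mul, mul_one]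

theorem smul_apply (w : D.N) (θ : D.DX) (f : D.CX) :
    (w • θ).1 f = D.act w (θ.1 (D.act w⁻¹ f)) := rfl

theorem smul_functionOp (w : D.N) (f : D.CX) :
    w • functionOp D.CX f = functionOp D.CX (D.act w f) := by
  apply Subtype.ext
  ext g
  rw [smul_apply]
  change D.act w (f * D.act w⁻¹ g) = D.act w f * g
  rw [map_mul, ← act_symm, AlgEquiv.apply_symm_apply]

theorem gp_mul_fnHom (w : D.N) (f : D.CX) :
    D.gp w * D.fnHom f = D.fnHom (D.act w f) * D.gp w :=
  (D.gp_mul_opHom w _).trans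
    (congrArg (fun θ => D.opHom θ * D.gp w) (D.smul_functionOp w f))

/-- The derivation `∂_y`, as an element of `𝒟(X)`, linearly in `y`. -/
def partialOp : V →ₗ[ℂ] D.DX where
  toFun y := derivationOp (D.partialDeriv y)
  map_add' y y' := by rw [partialDeriv_add]; rfl
  map_smul' c y := by rw [partialDeriv_smul]; rfl

theorem partialOp_apply (y : V) (f : D.CX) : (D.partialOp y).1 f = D.partialDeriv y f := rfl

theorem partialOp_comm (y y' : V) :
    D.partialOp y * D.partialOp y' = D.partialOp y' * D.partialOp y := by
  apply Subtype.ext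
  ext f
  exact D.partialDeriv_comm y y' f

theorem smul_partialOp (w : D.N) (y : V) :
    w • D.partialOp y = D.partialOp ((w : V ≃ₗ[ℂ] V) y) := by
  apply Subtype.ext
  ext f
  rw [smul_apply]
  change D.act w (D.partialDeriv y (D.act w⁻¹ f)) = D.partialDeriv _ f
  rw [act_partialDeriv, ← act_symm, AlgEquiv.apply_symm_apply]

theorem partialOp_mul_functionOp (y : V) (f : D.CX) :
    D.partialOp y * functionOp D.CX f =
      functionOp D.CX f * D.partialOp y + functionOp D.CX (D.partialDeriv y f) := by
  apply Subtype.ext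
  ext g
  change D.partialDeriv y (f * g) = f * D.partialDeriv y g + D.partialDeriv y f * g
  rw [Derivation.leibniz, smul_eq_mul, smul_eq_mul, mul_comm g]

/-- A subalgebra of `𝒟(X) ⋊ N` that contains `𝒟(X)` and `N` is everything. -/
theorem subalgebra_DXSkew_eq_top (S : Subalgebra ℂ D.DXSkew) (h1 : ∀ θ, D.opHom θ ∈ S)
    (h2 : ∀ w, D.gp w ∈ S) : S = ⊤ := by
  refine Algebra.eq_top_iff.2 fun P => ?_
  induction P using SkewMonoidAlgebra.induction_on with
  | zero => exact S.zero_mem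
  | single w θ => rw [← coeff_opHom_mul_gp]; exact S.mul_mem (h1 θ) (h2 w)
  | add P Q hP hQ => exact S.add_mem hP hQ

/-- The action of `𝒟(X) ⋊ N` on `ℂ[X]`. -/
def rep : D.DXSkew →ₐ[ℂ] Module.End ℂ D.CX :=
  SkewMonoidAlgebra.liftNCAlgHom (k := ℂ) (diffOps D.CX).val
    { toFun := fun w => (D.act w).toLinearMap
      map_one' := by rw [act_one]; rfl
      map_mul' := fun g h => by rw [act_mul]; rfl }
    (by
      intro θ w
      ext f
      change (w • θ).1 (D.act w f) = D.act w (θ.1 f)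
      rw [smul_apply, ← act_symm, AlgEquiv.symm_apply_apply])

theorem rep_single (w : D.N) (θ : D.DX) (f : D.CX) :
    D.rep (SkewMonoidAlgebra.single w θ) f = θ.1 (D.act w f) := by
  have h : D.rep (SkewMonoidAlgebra.single w θ) = θ.1 * (D.act w).toLinearMap :=
    SkewMonoidAlgebra.liftNC_single _ _ _ _
  rw [h]
  rfl

theorem rep_opHom (θ : D.DX) (f : D.CX) : D.rep (D.opHom θ) f = θ.1 f := by
  change D.rep (SkewMonoidAlgebra.single 1 θ) f = _
  rw [rep_single, act_one]
  rfl

theorem rep_fnHom (f g : D.CX) : D.rep (D.fnHom f) g = f * g := D.rep_opHom _ g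

theorem rep_gp (w : D.N) (f : D.CX) : D.rep (D.gp w) f = D.act w f :=
  D.rep_single w 1 f

end ReflectionPair
end

noncomputable section

namespace ReflectionPair

variable {V : Type*} [AddCommGroup V] [Module ℂ V] (D : ReflectionPair V)

/-! ### Pointwise stabilisers of hyperplanes -/

theorem mem_hyperplanes₀ {H : Submodule ℂ V} : H ∈ D.hyperplanes₀ ↔ H ∈ arrangement D.W₀ := by
  simp [hyperplanes₀]

theorem arrangement_W₀_subset {H : Submodule ℂ V} (hH : H ∈ arrangement D.W₀) :
    H ∈ arrangement D.W := by
  obtain ⟨s, hs, h⟩ := hH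
  exact ⟨s, D.W₀_le hs, h⟩

theorem map_mem_arrangement₀ (g : D.N) {H : Submodule ℂ V} (hH : H ∈ arrangement D.W₀) :
    H.map ((g : V ≃ₗ[ℂ] V) : V →ₗ[ℂ] V) ∈ arrangement D.W₀ := by
  obtain ⟨s, hs, hr, rfl⟩ := hH
  refine ⟨g * s * (g : V ≃ₗ[ℂ] V)⁻¹, ?_, ?_, fixedSpace_conj _ s⟩
  · exact (Subgroup.mem_normalizer_iff.1 g.2.2 s).1 hs
  · unfold IsReflection at *
    rw [fixedSpace_conj, ← hr]
    congr 1
    exact LinearEquiv.finrank_map_eq (g : V ≃ₗ[ℂ] V) (fixedSpace s)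

theorem α_v_ne_zero {H : Submodule ℂ V} (hH : H ∈ arrangement D.W₀) : D.α H (D.v H) ≠ 0 := by
  intro h
  have hker := D.ker_α H (D.arrangement_W₀_subset hH)
  have hc := D.isCompl_v H hH
  have hv : D.v H ∈ H := hker.le h
  have hle : Submodule.span ℂ {D.v H} ≤ H := by simpa using hv
  have htop : H = ⊤ := by
    have := hc.sup_eq_top
    rwa [sup_eq_right.2 hle] at this
  obtain ⟨s, -, hs, hs'⟩ := hH
  unfold IsReflection at hs
  rw [hs', htop, finrank_top] at hs
  omega

/-- The determinant of an element of `N`. -/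
def dt (w : D.N) : ℂ := LinearMap.det (w : V ≃ₗ[ℂ] V).toLinearMap

theorem dt_mul (w w' : D.N) : D.dt (w * w') = D.dt w * D.dt w' :=
  LinearMap.det_comp _ _

theorem dt_one : D.dt 1 = 1 := LinearMap.det_id

theorem dt_ne_zero (w : D.N) : D.dt w ≠ 0 := by
  intro h
  have := D.dt_mul w w⁻¹
  rw [mul_inv_cancel, dt_one, h, zero_mul] at this
  exact one_ne_zero this

theorem dt_pow (w : D.N) (n : ℕ) : D.dt (w ^ n) = D.dt w ^ n := by
  induction n with
  | zero => simp [dt_one]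
  | succ n ih => rw [pow_succ, pow_succ, dt_mul, ih]

theorem dt_conj (g w : D.N) : D.dt (g * w * g⁻¹) = D.dt w := by
  rw [dt_mul, mul_comm, ← dt_mul, inv_mul_cancel_left]

theorem dt_pow_m {H : Submodule ℂ V} (w : D.stab H) : D.dt w ^ D.m H = 1 := by
  rw [← dt_pow]
  have : w ^ D.m H = 1 := pow_card_eq_one'
  have h : ((w ^ D.m H : D.stab H) : D.N) = 1 := by rw [this]; rfl
  rw [Subgroup.coe_pow] at h
  rw [h, dt_one]

/-- w is the identity on H and multiplies v_H by a scalar c, so it is the identity plus a rank-one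
map; its determinant is 1 + (c - 1) = c. -/
theorem stab_apply [FiniteDimensional ℂ V] {H : Submodule ℂ V} (hH : H ∈ arrangement D.W₀) (w : D.stab H) (y : V) :
    ((w : D.N) : V ≃ₗ[ℂ] V) y =
      y + ((D.dt w - 1) * D.α H y / D.α H (D.v H)) • D.v H := by
  have hv := D.α_v_ne_zero hH
  have hker := D.ker_α H (D.arrangement_W₀_subset hH)
  obtain ⟨c, hc⟩ := Submodule.mem_span_singleton.1
    (D.v_stable H hH ⟨((w : D.N) : V ≃ₗ[ℂ] V), D.N_le (w : D.N).2⟩ w.2)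
  have hc' : c • D.v H = ((w : D.N) : V ≃ₗ[ℂ] V) (D.v H) := hc
  have key : ∀ y, ((w : D.N) : V ≃ₗ[ℂ] V) y = y + ((c - 1) * D.α H y / D.α H (D.v H)) • D.v H := by
    intro y
    have hmem : y - (D.α H y / D.α H (D.v H)) • D.v H ∈ H := by
      apply hker.le
      rw [LinearMap.mem_ker, map_sub, map_smul, smul_eq_mul, div_mul_cancel₀ _ hv, sub_self]
    have h := w.2 _ hmem
    rw [map_sub, map_smul, ← hc', sub_eq_iff_eq_add] at h
    rw [h, smul_smul, sub_add, ← sub_smul, sub_eq_add_neg, ← neg_smul]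
    congr 2
    ring
  have hdet : D.dt w = c := by
    have : ((w : D.N) : V ≃ₗ[ℂ] V).toLinearMap =
        LinearMap.transvection (((c - 1) / D.α H (D.v H)) • D.α H) (D.v H) := by
      ext y
      rw [LinearMap.transvection.apply, LinearEquiv.coe_coe, key, LinearMap.smul_apply, smul_eq_mul,
        div_mul_eq_mul_div]
    rw [dt, this, LinearMap.transvection.det, LinearMap.smul_apply, smul_eq_mul,
      div_mul_cancel₀ _ hv, add_sub_cancel]
  rw [hdet, key]

/-- The contragredient of a rank-one perturbation of the identity is again one, with det(w) replaced
by its inverse. The factor det(w)⁻¹ - 1 is the one that reappears in `γ_eq`. -/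
theorem dualAct_stab [FiniteDimensional ℂ V] {H : Submodule ℂ V} (hH : H ∈ arrangement D.W₀) (w : D.stab H)
    (x : Module.Dual ℂ V) :
    dualAct ((w : D.N) : V ≃ₗ[ℂ] V) x =
      x + (((D.dt w)⁻¹ - 1) * (x (D.v H) / D.α H (D.v H))) • D.α H := by
  have hv := D.α_v_ne_zero hH
  have hd := D.dt_ne_zero w
  ext y
  obtain ⟨z, rfl⟩ := ((w : D.N) : V ≃ₗ[ℂ] V).surjective y
  have h : (((w : D.N) : V ≃ₗ[ℂ] V)⁻¹ : V ≃ₗ[ℂ] V) (((w : D.N) : V ≃ₗ[ℂ] V) z) = z :=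
    ((w : D.N) : V ≃ₗ[ℂ] V).symm_apply_apply z
  rw [dualAct_apply, h, D.stab_apply hH]
  simp only [LinearMap.add_apply, LinearMap.smul_apply, map_add, map_smul, smul_eq_mul]
  field_simp
  ring

/-- The coefficient of `w` in `a_H`. -/
def aCoeff (H : Submodule ℂ V) (w : D.stab H) : ℂ :=
  ∑ j ∈ Finset.range (D.m H), D.k H j * D.dt w ^ j

theorem m_ne_zero (H : Submodule ℂ V) : (D.m H : ℂ) ≠ 0 := by
  have : D.m H ≠ 0 := Nat.card_pos.ne'
  exact_mod_cast this

theorem sum_smul_ε (H : Submodule ℂ V) (c : ℕ → ℂ) :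
    ∑ j ∈ Finset.range (D.m H), ((D.m H : ℂ) * c j) • D.ε H j =
      ∑ w : D.stab H, (∑ j ∈ Finset.range (D.m H), c j * D.dt w ^ j) •
        MonoidAlgebra.of ℂ D.N (w : D.N) := by
  simp only [Finset.sum_smul]
  rw [Finset.sum_comm]
  refine Finset.sum_congr rfl fun j _ => ?_
  rw [ε, smul_smul, mul_right_comm, mul_inv_cancel₀ (D.m_ne_zero H), one_mul, Finset.smul_sum]
  exact Finset.sum_congr rfl fun w _ => smul_smul _ _ _

theorem a_eq (H : Submodule ℂ V) :
    D.a H = ∑ w : D.stab H, D.aCoeff H w • MonoidAlgebra.of ℂ D.N (w : D.N) :=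
  D.sum_smul_ε H _

theorem sum_range_succ_mod (m : ℕ) (hm : m ≠ 0) (f : ℕ → ℂ) :
    ∑ j ∈ Finset.range m, f ((j + 1) % m) = ∑ j ∈ Finset.range m, f j := by
  obtain ⟨n, rfl⟩ := Nat.exists_eq_succ_of_ne_zero hm
  rw [Finset.sum_range_succ, Finset.sum_range_succ', Nat.succ_eq_add_one, Nat.mod_self]
  congr 1
  refine Finset.sum_congr rfl fun j hj => ?_
  rw [Nat.mod_eq_of_lt]
  have := Finset.mem_range.1 hj
  omega

/-- Replacing k_{H,j} by k_{H,j+1} multiplies the coefficient of w by det(w)⁻¹: shift j cyclically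
and use det(w)^{m_H} = 1. -/
theorem γ_eq (H : Submodule ℂ V) :
    D.γ H = ∑ w : D.stab H, (D.aCoeff H w * ((D.dt w)⁻¹ - 1)) •
      MonoidAlgebra.of ℂ D.N (w : D.N) := by
  rw [γ, sum_smul_ε]
  refine Finset.sum_congr rfl fun w _ => ?_
  congr 1
  have hd := D.dt_ne_zero w
  have hm : D.m H ≠ 0 := Nat.card_pos.ne'
  have h1 : ∑ j ∈ Finset.range (D.m H), D.k H ((j + 1) % D.m H) * D.dt w ^ j =
      D.aCoeff H w * (D.dt w)⁻¹ := by
    rw [eq_mul_inv_iff_mul_eq₀ hd, aCoeff,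
      ← sum_range_succ_mod (D.m H) hm fun j => D.k H j * D.dt w ^ j, Finset.sum_mul]
    refine Finset.sum_congr rfl fun j _ => ?_
    have : D.dt w ^ ((j + 1) % D.m H) = D.dt w ^ (j + 1) := by
      conv_rhs => rw [← Nat.mod_add_div (j + 1) (D.m H), pow_add, pow_mul, dt_pow_m, one_pow,
        mul_one]
    rw [this, pow_succ, mul_assoc]
  simp only [sub_mul, Finset.sum_sub_distrib]
  rw [h1, mul_sub, mul_one]
  rfl

/-- Conjugation by `g ∈ N` from the stabiliser of `H` to that of `g(H)`. -/
def stabConj (g : D.N) (H : Submodule ℂ V) :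
    D.stab H ≃ D.stab (H.map ((g : V ≃ₗ[ℂ] V) : V →ₗ[ℂ] V)) where
  toFun w := ⟨g * w * g⁻¹, by
    rintro _ ⟨u, hu, rfl⟩
    change (g : V ≃ₗ[ℂ] V) (((w : D.N) : V ≃ₗ[ℂ] V) ((g : V ≃ₗ[ℂ] V).symm
      ((g : V ≃ₗ[ℂ] V) u))) = (g : V ≃ₗ[ℂ] V) u
    rw [LinearEquiv.symm_apply_apply, w.2 u hu]⟩
  invFun w := ⟨g⁻¹ * w * g, by
    intro u hu
    change (g : V ≃ₗ[ℂ] V).symm (((w : D.N) : V ≃ₗ[ℂ] V) ((g : V ≃ₗ[ℂ] V) u)) = u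
    have h := w.2 _ (Submodule.mem_map_of_mem (f := ((g : V ≃ₗ[ℂ] V) : V →ₗ[ℂ] V)) hu)
    exact (congrArg (g : V ≃ₗ[ℂ] V).symm h).trans ((g : V ≃ₗ[ℂ] V).symm_apply_apply u)⟩
  left_inv w := by
    apply Subtype.ext
    change g⁻¹ * (g * w * g⁻¹) * g = (w : D.N)
    group
  right_inv w := by
    apply Subtype.ext
    change g * (g⁻¹ * w * g) * g⁻¹ = (w : D.N)
    group

/-- Conjugation preserves the determinant and m_H, and the parameters are N-invariant in the range j
< m_H that occurs. -/
theorem aCoeff_stabConj (g : D.N) {H : Submodule ℂ V} (hH : H ∈ arrangement D.W₀)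
    (w : D.stab H) : D.aCoeff _ (D.stabConj g H w) = D.aCoeff H w := by
  have hm : D.m (H.map ((g : V ≃ₗ[ℂ] V) : V →ₗ[ℂ] V)) = D.m H :=
    (Nat.card_congr (D.stabConj g H)).symm
  have hd : D.dt (D.stabConj g H w) = D.dt w := D.dt_conj g w
  rw [aCoeff, aCoeff, hm, hd]
  refine Finset.sum_congr rfl fun j hj => ?_
  rw [D.k_map g g.2 H hH j (Finset.mem_range.1 hj)]

end ReflectionPair
end

noncomputable section

namespace ReflectionPair

variable {V : Type*} [AddCommGroup V] [Module ℂ V] (D : ReflectionPair V)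

/-! ### Dunkl operators -/

/-- The ring structure of `𝒟(X) ⋊ N`. -/
@[reducible] def ringDXSkew : Ring D.DXSkew := Algebra.semiringToRing ℂ

attribute [local instance 10] ringDXSkew

/-- The inverse of `α_H` in `ℂ[X]`. -/
def invα (H : Submodule ℂ V) : D.CX := Ring.inverse (D.coord (D.α H))

theorem invα_mul {H : Submodule ℂ V} (hH : H ∈ arrangement D.W) :
    D.invα H * D.coord (D.α H) = 1 := Ring.inverse_mul_cancel _ (D.isUnit_coord_α hH)

theorem groupToDXSkew_of (w : D.N) : D.groupToDXSkew (MonoidAlgebra.of ℂ D.N w) = D.gp w :=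
  MonoidAlgebra.lift_of _ _

theorem groupToDXSkew_a (H : Submodule ℂ V) :
    D.groupToDXSkew (D.a H) = ∑ w : D.stab H, D.aCoeff H w • D.gp (w : D.N) := by
  simp only [a_eq, map_sum, map_smul, groupToDXSkew_of]

theorem groupToDXSkew_γ (H : Submodule ℂ V) :
    D.groupToDXSkew (D.γ H) =
      ∑ w : D.stab H, (D.aCoeff H w * ((D.dt w)⁻¹ - 1)) • D.gp (w : D.N) := by
  simp only [γ_eq, map_sum, map_smul, groupToDXSkew_of]

theorem dunkl_eq (y : V) : D.dunkl y = D.opHom (D.partialOp y) +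
    ∑ H ∈ D.hyperplanes₀, D.α H y • (D.fnHom (D.invα H) * D.groupToDXSkew (D.a H)) := rfl

/-- The Dunkl operator `T_y`, linearly in `y`. -/
def dunklLinear : V →ₗ[ℂ] D.DXSkew where
  toFun := D.dunkl
  map_add' y y' := by
    simp only [dunkl_eq, map_add, add_smul, Finset.sum_add_distrib]
    abel
  map_smul' c y := by
    simp only [dunkl_eq, map_smul, smul_add, Finset.smul_sum, smul_smul, smul_eq_mul,
      RingHom.id_apply]

theorem dunklLinear_apply (y : V) : D.dunklLinear y = D.dunkl y := rfl

theorem gp_mul_a (g : D.N) {H : Submodule ℂ V} (hH : H ∈ arrangement D.W₀) :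
    D.gp g * D.groupToDXSkew (D.a H) =
      D.groupToDXSkew (D.a (H.map ((g : V ≃ₗ[ℂ] V) : V →ₗ[ℂ] V))) * D.gp g := by
  rw [groupToDXSkew_a, groupToDXSkew_a, Finset.mul_sum, Finset.sum_mul,
    ← (D.stabConj g H).sum_comp]
  refine Finset.sum_congr rfl fun w _ => ?_
  rw [D.aCoeff_stabConj g hH, mul_smul_comm, smul_mul_assoc, ← map_mul, ← map_mul]
  congr 2
  exact (inv_mul_cancel_right _ _).symm

/-- Here gα_H = c α_{gH}. The inverse form acquires c⁻¹ and the value α_H(y) acquires c, so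
α_H(y)/α_H goes to α_{gH}(gy)/α_{gH} whatever the choice of the forms. -/
theorem act_invα (g : D.N) {H : Submodule ℂ V} (hH : H ∈ arrangement D.W) :
    ∃ c : ℂ, D.act g (D.invα H) = c⁻¹ • D.invα (H.map ((g : V ≃ₗ[ℂ] V) : V →ₗ[ℂ] V)) ∧
      c ≠ 0 ∧
      ∀ y, D.α H y = c * D.α (H.map ((g : V ≃ₗ[ℂ] V) : V →ₗ[ℂ] V)) ((g : V ≃ₗ[ℂ] V) y) := by
  obtain ⟨c, hc, h⟩ := D.exists_dualAct_α (D.N_le g.2) hH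
  refine ⟨c, ?_, hc, fun y => ?_⟩
  · have h1 := congrArg (D.act g) (D.invα_mul hH)
    rw [map_mul, map_one, act_coord, h, coord_smul] at h1
    have h2 := D.invα_mul (map_mem_arrangement (D.N_le g.2) hH)
    have h3 : IsUnit (c • D.coord (D.α (H.map ((g : V ≃ₗ[ℂ] V) : V →ₗ[ℂ] V)))) :=
      IsUnit.of_mul_eq_one_right _ h1
    refine h3.mul_right_cancel ?_
    rw [h1, smul_mul_smul_comm, h2, inv_mul_cancel₀ hc, one_smul]
  · have := congrArg (fun x => x ((g : V ≃ₗ[ℂ] V) y)) h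
    simp only [dualAct_apply, LinearMap.smul_apply, smul_eq_mul] at this
    rw [← this]
    congr 1
    exact ((g : V ≃ₗ[ℂ] V).symm_apply_apply y).symm

/-- N permutes the hyperplanes of W₀, so the sum is reindexed by H ↦ g(H); the two scalars in
`act_invα` cancel. -/
theorem gp_mul_dunkl (g : D.N) (y : V) :
    D.gp g * D.dunkl y = D.dunkl ((g : V ≃ₗ[ℂ] V) y) * D.gp g := by
  rw [dunkl_eq, dunkl_eq, mul_add, add_mul, gp_mul_opHom, smul_partialOp, Finset.mul_sum,
    Finset.sum_mul]
  congr 1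
  refine Finset.sum_nbij (fun H => H.map ((g : V ≃ₗ[ℂ] V) : V →ₗ[ℂ] V)) ?_ ?_ ?_ ?_
  · intro H hH
    exact D.mem_hyperplanes₀.2 (D.map_mem_arrangement₀ g (D.mem_hyperplanes₀.1 hH))
  · intro H _ H' _ h
    exact Submodule.map_injective_of_injective (g : V ≃ₗ[ℂ] V).injective h
  · intro H hH
    refine ⟨H.map (((g⁻¹ : D.N) : V ≃ₗ[ℂ] V) : V →ₗ[ℂ] V), ?_, ?_⟩
    · exact D.mem_hyperplanes₀.2 (D.map_mem_arrangement₀ g⁻¹ (D.mem_hyperplanes₀.1 hH))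
    · change (H.map _).map _ = H
      rw [← Submodule.map_comp]
      convert Submodule.map_id H
      ext u
      exact (g : V ≃ₗ[ℂ] V).apply_symm_apply u
  · intro H hH
    have hH₀ := D.mem_hyperplanes₀.1 hH
    obtain ⟨c, h1, hc, h2⟩ := D.act_invα g (D.arrangement_W₀_subset hH₀)
    rw [mul_smul_comm, smul_mul_assoc, ← mul_assoc, gp_mul_fnHom, mul_assoc, D.gp_mul_a g hH₀,
      ← mul_assoc, h1, map_smul, smul_mul_assoc, smul_mul_assoc, smul_smul, h2 y,
      mul_right_comm, mul_inv_cancel₀ hc, one_mul]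

variable [FiniteDimensional ℂ V]

/-- Moving x to the left of w replaces it by wx, and wx - x is a multiple of (det(w)⁻¹ - 1) α_H.
That factor converts the coefficient of w in a_H into its coefficient in γ_H. -/
theorem a_mul_coord {H : Submodule ℂ V} (hH : H ∈ arrangement D.W₀) (x : Module.Dual ℂ V) :
    D.groupToDXSkew (D.a H) * D.fnHom (D.coord x) =
      D.fnHom (D.coord x) * D.groupToDXSkew (D.a H) + (x (D.v H) / D.α H (D.v H)) •
        (D.fnHom (D.coord (D.α H)) * D.groupToDXSkew (D.γ H)) := by
  simp only [groupToDXSkew_a, groupToDXSkew_γ, Finset.sum_mul, Finset.mul_sum, Finset.smul_sum]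
  rw [← Finset.sum_add_distrib]
  refine Finset.sum_congr rfl fun w _ => ?_
  rw [smul_mul_assoc, gp_mul_fnHom, act_coord, D.dualAct_stab hH, coord_add, coord_smul, map_add,
    map_smul, add_mul, smul_add, mul_smul_comm, mul_smul_comm, smul_mul_assoc, smul_smul, smul_smul]
  congr 2
  ring

/-- ∂_y contributes x(y); in the other terms the factor α_H produced by `a_mul_coord` cancels the
denominator of T_y. -/
theorem dunkl_mul_coord (y : V) (x : Module.Dual ℂ V) :
    D.dunkl y * D.fnHom (D.coord x) - D.fnHom (D.coord x) * D.dunkl y =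
      algebraMap ℂ D.DXSkew (x y) + ∑ H ∈ D.hyperplanes₀,
        (D.α H y * x (D.v H) / D.α H (D.v H)) • D.groupToDXSkew (D.γ H) := by
  have h1 : D.opHom (D.partialOp y) * D.fnHom (D.coord x) =
      D.fnHom (D.coord x) * D.opHom (D.partialOp y) + algebraMap ℂ D.DXSkew (x y) := by
    have := congrArg D.opHom (D.partialOp_mul_functionOp y (D.coord x))
    rw [partialDeriv_coord, map_add, map_mul, map_mul, AlgHom.commutes, AlgHom.commutes] at this
    exact this
  have h2 : ∀ H ∈ D.hyperplanes₀,
      (D.α H y • (D.fnHom (D.invα H) * D.groupToDXSkew (D.a H))) * D.fnHom (D.coord x) =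
      D.fnHom (D.coord x) * (D.α H y • (D.fnHom (D.invα H) * D.groupToDXSkew (D.a H))) +
        (D.α H y * x (D.v H) / D.α H (D.v H)) • D.groupToDXSkew (D.γ H) := by
    intro H hH
    have hH₀ := D.mem_hyperplanes₀.1 hH
    rw [smul_mul_assoc, mul_assoc, D.a_mul_coord hH₀, mul_add, mul_smul_comm, ← mul_assoc,
      ← mul_assoc, ← map_mul, ← map_mul, D.invα_mul (D.arrangement_W₀_subset hH₀), map_one, one_mul,
      smul_add, smul_smul, mul_smul_comm, ← mul_assoc, ← map_mul, mul_comm (D.coord x), mul_div_assoc]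
  rw [dunkl_eq, add_mul, mul_add, h1, Finset.sum_mul, Finset.sum_congr rfl h2,
    Finset.sum_add_distrib, ← Finset.mul_sum]
  abel

/-- The commutator of `γ_H` with a Dunkl operator `T_y` is proportional to `α_H(y)`. -/
theorem dunkl_mul_γ {H : Submodule ℂ V} (hH : H ∈ arrangement D.W₀) :
    ∃ Z : D.DXSkew, ∀ y, D.dunkl y * D.groupToDXSkew (D.γ H) -
      D.groupToDXSkew (D.γ H) * D.dunkl y = D.α H y • Z := by
  -- By equivariance T_y w - w T_y = (T_y - T_{wy}) w, and y - wy is -(det(w) - 1) α_H(y)/α_H(v_H)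
  -- times v_H.
  refine ⟨∑ w : D.stab H, (D.aCoeff H w * ((D.dt w)⁻¹ - 1) *
    -((D.dt w - 1) / D.α H (D.v H))) • (D.dunkl (D.v H) * D.gp (w : D.N)), fun y => ?_⟩
  rw [groupToDXSkew_γ, Finset.mul_sum, Finset.sum_mul, ← Finset.sum_sub_distrib, Finset.smul_sum]
  refine Finset.sum_congr rfl fun w _ => ?_
  rw [mul_smul_comm, smul_mul_assoc, gp_mul_dunkl, ← smul_sub, ← sub_mul, D.stab_apply hH]
  simp only [← dunklLinear_apply]
  rw [map_add, map_smul, sub_add_cancel_left, ← neg_smul, smul_mul_assoc, smul_smul, smul_smul]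
  congr 1
  ring

/-- The commutator of two Dunkl operators. -/
def dunklComm (y y' : V) : D.DXSkew := D.dunkl y * D.dunkl y' - D.dunkl y' * D.dunkl y

/-- Jacobi identity: the commutator with x is the difference of two double commutators. In [T_z,
[T_z', x]] the scalar x(z') drops out and [T_z, γ_H] is proportional to α_H(z), so every coefficient
involves only α_H(z) α_H(z'). -/
theorem dunklComm_coord (y y' : V) (x : Module.Dual ℂ V) :
    D.dunklComm y y' * D.fnHom (D.coord x) = D.fnHom (D.coord x) * D.dunklComm y y' := by
  have key : ∀ z z' : V, D.dunkl z * (D.dunkl z' * D.fnHom (D.coord x) -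
      D.fnHom (D.coord x) * D.dunkl z') - (D.dunkl z' * D.fnHom (D.coord x) -
      D.fnHom (D.coord x) * D.dunkl z') * D.dunkl z = ∑ H ∈ D.hyperplanes₀,
        (D.α H z' * x (D.v H) / D.α H (D.v H)) • (D.dunkl z * D.groupToDXSkew (D.γ H) -
          D.groupToDXSkew (D.γ H) * D.dunkl z) := by
    intro z z'
    rw [dunkl_mul_coord, mul_add, add_mul, Finset.mul_sum, Finset.sum_mul, Algebra.commutes,
      add_sub_add_left_eq_sub, ← Finset.sum_sub_distrib]
    refine Finset.sum_congr rfl fun H _ => ?_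
    rw [mul_smul_comm, smul_mul_assoc, smul_sub]
  have hsym : D.dunkl y * (D.dunkl y' * D.fnHom (D.coord x) -
      D.fnHom (D.coord x) * D.dunkl y') - (D.dunkl y' * D.fnHom (D.coord x) -
      D.fnHom (D.coord x) * D.dunkl y') * D.dunkl y = D.dunkl y' * (D.dunkl y *
      D.fnHom (D.coord x) - D.fnHom (D.coord x) * D.dunkl y) - (D.dunkl y * D.fnHom (D.coord x) -
      D.fnHom (D.coord x) * D.dunkl y) * D.dunkl y' := by
    rw [key, key]
    refine Finset.sum_congr rfl fun H hH => ?_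
    obtain ⟨Z, hZ⟩ := D.dunkl_mul_γ (D.mem_hyperplanes₀.1 hH)
    rw [hZ, hZ, smul_smul, smul_smul]
    congr 1
    ring
  rw [← sub_eq_zero] at hsym ⊢
  rw [← hsym, dunklComm]
  noncomm_ring

/-! ### The commutant of the functions -/

omit [FiniteDimensional ℂ V] in
-- The functions commuting with P form a subalgebra. If it contains gδ and δ, cancelling the unit δ
-- shows that it contains g.
theorem commute_fnHom_of_coord {P : D.DXSkew}
    (h : ∀ x, P * D.fnHom (D.coord x) = D.fnHom (D.coord x) * P) (f : D.CX) :
    P * D.fnHom f = D.fnHom f * P := by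
  let S : Subalgebra ℂ D.CX := (Subalgebra.centralizer ℂ {P}).comap D.fnHom
  have hmem : ∀ f, f ∈ S ↔ P * D.fnHom f = D.fnHom f * P := fun f => by
    simp [S, Subalgebra.mem_centralizer_iff]
  have hS : S = ⊤ := D.subalgebra_CX_eq_top S (fun x => (hmem _).2 (h x)) fun g hg => by
    have h1 := (hmem _).1 (D.algebraMap_mem_of_coord_mem S (fun x => (hmem _).2 (h x)) D.δ)
    have h2 := (hmem _).1 hg
    refine (hmem _).2 (((D.isUnit_algebraMap_δ).map D.fnHom).mul_right_cancel ?_)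
    rw [map_mul, mul_assoc (D.fnHom g), ← h1, ← mul_assoc, ← mul_assoc] at h2
    exact h2
  exact (hmem f).1 (hS ▸ Algebra.mem_top)

end ReflectionPair
end

noncomputable section

namespace ReflectionPair

variable {V : Type*} [AddCommGroup V] [Module ℂ V] (D : ReflectionPair V)

attribute [local instance 10] ringDXSkew

/-! ### Integrality of ℂ[X], faithfulness of N, and the commutant computation. -/

theorem α_ne_zero {H : Submodule ℂ V} (hH : H ∈ arrangement D.W) : D.α H ≠ 0 := by
  intro h
  have hker := D.ker_α H hH
  rw [h, LinearMap.ker_zero] at hker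
  obtain ⟨s, -, hs, hs'⟩ := hH
  unfold IsReflection at hs
  rw [hs', ← hker, finrank_top] at hs
  omega

theorem ι_ne_zero {x : Module.Dual ℂ V} (hx : x ≠ 0) : SymmetricAlgebra.ι ℂ _ x ≠ 0 := by
  intro h
  apply hx
  ext y
  have := congrArg (SymmetricAlgebra.lift (Module.Dual.eval ℂ V y)) h
  rwa [SymmetricAlgebra.lift_ι_apply, map_zero] at this

theorem δ_ne_zero : D.δ ≠ 0 :=
  Finset.prod_ne_zero_iff.2 fun _ hH => ι_ne_zero (D.α_ne_zero (D.mem_hyperplanes.1 hH))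

theorem powers_δ_le : Submonoid.powers D.δ ≤ nonZeroDivisors (PolyFun V) :=
  powers_le_nonZeroDivisors_of_noZeroDivisors D.δ_ne_zero

instance isDomain_CX : IsDomain D.CX :=
  IsLocalization.isDomain_of_le_nonZeroDivisors D.CX D.powers_δ_le

theorem algebraMap_CX_injective : Function.Injective (algebraMap (PolyFun V) D.CX) :=
  IsLocalization.injective D.CX D.powers_δ_le

theorem coord_injective : Function.Injective D.coord := by
  intro x x' h
  rw [← sub_eq_zero]
  by_contra hne
  refine ι_ne_zero hne (D.algebraMap_CX_injective ?_)
  rw [map_sub, RingHom.map_sub, RingHom.map_zero]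
  exact sub_eq_zero.2 h

theorem exists_dualAct_ne {w : D.N} (hw : w ≠ 1) :
    ∃ x : Module.Dual ℂ V, dualAct (w : V ≃ₗ[ℂ] V) x ≠ x := by
  by_contra! h
  apply hw
  apply Subtype.ext
  apply LinearEquiv.ext
  intro y
  change (w : V ≃ₗ[ℂ] V) y = y
  rw [← sub_eq_zero, ← Module.forall_dual_apply_eq_zero_iff ℂ]
  intro x
  have := congrArg (fun x => x ((w : V ≃ₗ[ℂ] V) y)) (h x)
  rw [map_sub, sub_eq_zero, ← this]
  exact congrArg x ((w : V ≃ₗ[ℂ] V).symm_apply_apply y)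

theorem functionOp_mul_apply {R : Type*} [CommRing R] [Algebra ℂ R] (f : R) (θ : diffOps R)
    (u : R) : (functionOp R f * θ).1 u = f * θ.1 u := rfl

theorem mul_functionOp_apply {R : Type*} [CommRing R] [Algebra ℂ R] (f : R) (θ : diffOps R)
    (u : R) : (θ * functionOp R f).1 u = θ.1 (f * u) := rfl

/-- A differential operator on a domain that intertwines two distinct functions is zero. -/
theorem eq_zero_of_intertwines {R : Type*} [CommRing R] [IsDomain R] [Algebra ℂ R] {f g : R}
    (hfg : f ≠ g) (θ : diffOps R) (h : θ * functionOp R g = functionOp R f * θ) : θ = 0 := by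
  -- The commutator of θ with g equals (f - g)θ. It has order one less and still intertwines f and
  -- g, so induction on the order gives a power of f - g that kills θ.
  have key : ∀ (n : ℕ) (θ : Module.End ℂ R), IsDiffOp R n θ → (∀ u, θ (g * u) = f * θ u) →
      ∀ u, (f - g) ^ (n + 1) * θ u = 0 := by
    intro n
    induction n with
    | zero =>
      intro θ hθ h u
      have := congrArg (fun η => η u) (hθ g)
      simp only [LinearMap.sub_apply, Module.End.mul_apply, LinearMap.mulLeft_apply,
        LinearMap.zero_apply, h, ← sub_mul] at this
      simpa using this
    | succ n ih =>
      intro θ hθ h u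
      have h' := ih _ (hθ g) (fun u => by
        simp only [LinearMap.sub_apply, Module.End.mul_apply, LinearMap.mulLeft_apply, h]
        ring) u
      simp only [LinearMap.sub_apply, Module.End.mul_apply, LinearMap.mulLeft_apply, h] at h'
      rw [pow_succ, mul_assoc, sub_mul f g (θ u)]
      exact h'
  obtain ⟨n, hn⟩ := θ.2
  apply Subtype.ext
  ext u
  have hu := key n θ.1 hn (fun u => congrArg (fun η : diffOps R => η.1 u) h) u
  exact (mul_eq_zero.1 hu).resolve_left (pow_ne_zero _ (sub_ne_zero.2 hfg))

/-- A differential operator that commutes with the functions is a function. -/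
theorem eq_functionOp_of_commute {R : Type*} [CommRing R] [Algebra ℂ R] (θ : diffOps R)
    (h : ∀ f, θ * functionOp R f = functionOp R f * θ) : θ = functionOp R (θ.1 1) := by
  apply Subtype.ext
  ext u
  have := congrArg (fun η : diffOps R => η.1 1) (h u)
  simp only [functionOp_mul_apply, mul_functionOp_apply, mul_one] at this
  rw [this, mul_comm]
  rfl

/-- The functions form a maximal commutative subalgebra of `𝒟(X) ⋊ N`. -/
theorem eq_fnHom_of_commute {P : D.DXSkew}
    (h : ∀ x, P * D.fnHom (D.coord x) = D.fnHom (D.coord x) * P) :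
    P = D.fnHom (D.rep P 1) := by
  classical
  -- Write P as the sum of P_w w. Moving f through w turns it into wf, and the coefficients of w on
  -- the two sides are compared.
  have hcoeff : ∀ (w : D.N) (f : D.CX), P.coeff w * functionOp D.CX (D.act w f) =
      functionOp D.CX f * P.coeff w := by
    intro w f
    have h1 : (P * SkewMonoidAlgebra.single 1 (functionOp D.CX f)).coeff w =
        (SkewMonoidAlgebra.single 1 (functionOp D.CX f) * P).coeff w :=
      congrArg (fun Q : D.DXSkew => Q.coeff w) (D.commute_fnHom_of_coord h f)
    rw [SkewMonoidAlgebra.coeff_mul_single_one, SkewMonoidAlgebra.coeff_single_one_mul] at h1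
    rw [← smul_functionOp]
    exact h1
  -- A nontrivial w moves some linear form x, so P_w intertwines the distinct functions x and wx and
  -- must vanish.
  have h0 : ∀ w : D.N, w ≠ 1 → P.coeff w = 0 := by
    intro w hw
    obtain ⟨x, hx⟩ := D.exists_dualAct_ne hw
    refine eq_zero_of_intertwines (f := D.coord x) (g := D.act w (D.coord x)) ?_ _ (hcoeff w _)
    rw [act_coord]
    exact fun h => hx (D.coord_injective h).symm
  have h1 := eq_functionOp_of_commute (P.coeff 1) (fun f => by
    have := hcoeff 1 f
    rwa [act_one] at this)
  have hP : P = D.fnHom ((P.coeff 1).1 1) := by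
    have : P = SkewMonoidAlgebra.single 1 (P.coeff 1) := by
      ext1 w
      rw [SkewMonoidAlgebra.coeff_single_apply]
      split_ifs with hw
      · rw [hw]
      · exact h0 w (Ne.symm hw)
    exact this.trans (congrArg (fun θ : D.DX => SkewMonoidAlgebra.single 1 θ) h1)
  have hr : D.rep P 1 = (P.coeff 1).1 1 := by
    conv_lhs => rw [hP, rep_fnHom, mul_one]
  rw [hr]
  exact hP

/-! ### Commutativity of the Dunkl operators -/

theorem rep_dunkl (y : V) (g : D.CX) : D.rep (D.dunkl y) g = D.partialDeriv y g +
    ∑ H ∈ D.hyperplanes₀, D.α H y •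
      (D.invα H * ∑ w : D.stab H, D.aCoeff H w • D.act (w : D.N) g) := by
  rw [dunkl_eq, map_add, map_sum, LinearMap.add_apply, LinearMap.sum_apply, rep_opHom,
    partialOp_apply]
  congr 1
  refine Finset.sum_congr rfl fun H _ => ?_
  rw [map_smul, map_mul, LinearMap.smul_apply, Module.End.mul_apply, rep_fnHom, groupToDXSkew_a,
    map_sum, LinearMap.sum_apply]
  congr 2
  refine Finset.sum_congr rfl fun w _ => ?_
  rw [map_smul, LinearMap.smul_apply, rep_gp]

/-- The function `T_y(1)`. -/
def dunklOne : V →ₗ[ℂ] D.CX := LinearMap.applyₗ 1 ∘ₗ D.rep.toLinearMap ∘ₗ D.dunklLinear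

theorem dunklOne_apply (y : V) : D.dunklOne y = D.rep (D.dunkl y) 1 := rfl

theorem act_dunklOne (w : D.N) (y : V) :
    D.act w (D.dunklOne y) = D.dunklOne ((w : V ≃ₗ[ℂ] V) y) := by
  have := congrArg (fun P => D.rep P 1) (D.gp_mul_dunkl w y)
  simp only [map_mul, Module.End.mul_apply, rep_gp, map_one] at this
  exact this

theorem dunklOne_eq (y : V) : D.dunklOne y = ∑ H ∈ D.hyperplanes₀,
    (D.α H y * ∑ w : D.stab H, D.aCoeff H w) • D.invα H := by
  rw [dunklOne_apply, rep_dunkl, Derivation.map_one_eq_zero, zero_add]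
  refine Finset.sum_congr rfl fun H _ => ?_
  simp only [map_one]
  rw [← Finset.sum_smul, mul_smul_comm, mul_one, smul_smul]

theorem partialDeriv_invα {H : Submodule ℂ V} (hH : H ∈ arrangement D.W) (y : V) :
    D.partialDeriv y (D.invα H) = -(D.α H y • (D.invα H * D.invα H)) := by
  have h := congrArg (D.partialDeriv y) (D.invα_mul hH)
  rw [Derivation.leibniz, partialDeriv_coord, Derivation.map_one_eq_zero, smul_eq_mul,
    smul_eq_mul] at h
  have h' := congrArg (D.invα H * ·) h
  simp only [mul_add, mul_zero, ← mul_assoc] at h'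
  rw [D.invα_mul hH, one_mul, mul_comm _ (algebraMap ℂ D.CX _), ← Algebra.smul_def] at h'
  exact eq_neg_of_add_eq_zero_right h'

variable [FiniteDimensional ℂ V]

/-- Apart from the product of T_y(1) and T_y'(1), there are two contributions. The derivative of
α_H(y')/α_H along y is -α_H(y) α_H(y')/α_H². An element w of N_H sends T_y'(1) to T_{wy'}(1), which
differs from T_y'(1) by a multiple of α_H(y') T_{v_H}(1). Everything is therefore symmetric in y and
y', which is what the existence of `ζ` independent of y and y' records. -/
theorem rep_dunkl_dunklOne : ∃ ζ : Submodule ℂ V → D.CX, ∀ y y' : V,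
    D.rep (D.dunkl y) (D.dunklOne y') = D.dunklOne y * D.dunklOne y' +
      ∑ H ∈ D.hyperplanes₀, (D.α H y * D.α H y') • ζ H := by
  refine ⟨fun H => D.invα H * ((∑ w : D.stab H, D.aCoeff H w *
    ((D.dt w - 1) / D.α H (D.v H))) • D.dunklOne (D.v H)) -
      (∑ w : D.stab H, D.aCoeff H w) • (D.invα H * D.invα H), fun y y' => ?_⟩
  have hderiv : D.partialDeriv y (D.dunklOne y') = ∑ H ∈ D.hyperplanes₀,
      (D.α H y * D.α H y') • -((∑ w : D.stab H, D.aCoeff H w) • (D.invα H * D.invα H)) := by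
    rw [dunklOne_eq, map_sum]
    refine Finset.sum_congr rfl fun H hH => ?_
    rw [Derivation.map_smul, D.partialDeriv_invα (D.arrangement_W₀_subset (D.mem_hyperplanes₀.1 hH)),
      smul_neg, smul_neg, smul_smul, smul_smul]
    congr 2
    ring
  have hH : ∀ H ∈ D.hyperplanes₀, D.α H y • (D.invα H *
      ∑ w : D.stab H, D.aCoeff H w • D.act (w : D.N) (D.dunklOne y')) =
      ((D.α H y * ∑ w : D.stab H, D.aCoeff H w) • D.invα H) * D.dunklOne y' +
      (D.α H y * D.α H y') • (D.invα H * ((∑ w : D.stab H, D.aCoeff H w *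
        ((D.dt w - 1) / D.α H (D.v H))) • D.dunklOne (D.v H))) := by
    intro H hH
    have h1 : ∑ w : D.stab H, D.aCoeff H w • D.act (w : D.N) (D.dunklOne y') =
        (∑ w : D.stab H, D.aCoeff H w) • D.dunklOne y' + D.α H y' •
          ((∑ w : D.stab H, D.aCoeff H w * ((D.dt w - 1) / D.α H (D.v H))) •
            D.dunklOne (D.v H)) := by
      rw [Finset.sum_smul, Finset.sum_smul, Finset.smul_sum, ← Finset.sum_add_distrib]
      refine Finset.sum_congr rfl fun w _ => ?_
      rw [act_dunklOne, D.stab_apply (D.mem_hyperplanes₀.1 hH), map_add, map_smul, smul_add,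
        smul_smul, smul_smul]
      congr 2
      ring
    rw [h1, mul_add, smul_add, mul_smul_comm, mul_smul_comm, smul_smul, smul_smul, smul_mul_assoc]
  rw [rep_dunkl, hderiv, Finset.sum_congr rfl hH, Finset.sum_add_distrib, ← Finset.sum_mul,
    ← dunklOne_eq, add_left_comm, ← Finset.sum_add_distrib]
  congr 1
  refine Finset.sum_congr rfl fun H _ => ?_
  rw [← smul_add, neg_add_eq_sub]

/-- The commutator commutes with all functions, hence is multiplication by its value at 1, and that
value vanishes by the symmetry in `rep_dunkl_dunklOne`. -/
theorem dunklComm_eq_zero (y y' : V) : D.dunklComm y y' = 0 := by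
  have h : D.rep (D.dunklComm y y') 1 = 0 := by
    obtain ⟨ζ, hζ⟩ := D.rep_dunkl_dunklOne
    have : D.rep (D.dunklComm y y') 1 =
        D.rep (D.dunkl y) (D.dunklOne y') - D.rep (D.dunkl y') (D.dunklOne y) := by
      rw [dunklComm, map_sub, map_mul, map_mul]
      rfl
    rw [this, hζ, hζ, mul_comm (D.dunklOne y), sub_eq_zero]
    congr 1
    exact Finset.sum_congr rfl fun H _ => by rw [mul_comm]
  rw [D.eq_fnHom_of_commute (D.dunklComm_coord y y'), h, map_zero]

theorem dunkl_comm (y y' : V) : D.dunkl y * D.dunkl y' = D.dunkl y' * D.dunkl y :=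
  sub_eq_zero.1 (D.dunklComm_eq_zero y y')

end ReflectionPair
end

noncomputable section

/-! ### Polynomial differential operators in an abstract algebra -/

namespace WeylPair

variable {A : Type*} [Ring A] [Algebra ℂ A] {ι : Type*} (X d : ι → A)

/-- The commutator `a ↦ [a, X i]`. -/
def ad (i : ι) : A →ₗ[ℂ] A := LinearMap.mulRight ℂ (X i) - LinearMap.mulLeft ℂ (X i)

theorem ad_apply (i : ι) (a : A) : ad X i a = a * X i - X i * a := rfl

theorem ad_eq_of_mul_eq {i : ι} {a c : A} (h : a * X i = X i * a + c) : ad X i a = c := by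
  rw [ad_apply, h, add_sub_cancel_left]

theorem ad_mul (i : ι) (a b : A) : ad X i (a * b) = ad X i a * b + a * ad X i b := by
  simp only [ad_apply]
  noncomm_ring

theorem ad_comm (hX : ∀ i j, X i * X j = X j * X i) (i j : ι) (a : A) :
    ad X i (ad X j a) = ad X j (ad X i a) := by
  have h : ∀ i j, ad X i (X j) = 0 := fun i j => by rw [ad_apply, hX, sub_self]
  rw [ad_apply X j a, map_sub, ad_mul, ad_mul, h, ad_apply X j]
  simp

/-- `IsOrdLT X n a`: all the `n`-fold commutators of `a` with the `X i` vanish. -/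
def IsOrdLT : ℕ → A → Prop
  | 0, a => a = 0
  | n + 1, a => ∀ i, IsOrdLT n (ad X i a)

/-- `X` and `d` satisfy the canonical commutation relations. -/
structure Relations [DecidableEq ι] : Prop where
  comm_X : ∀ i j, X i * X j = X j * X i
  ad_d : ∀ i j, ad X i (d j) = if i = j then 1 else 0

section

variable {X d} [DecidableEq ι] (h : Relations X d)

include h

section Euler

variable [Fintype ι]

/-- Since [d_j, X_i] is 1 or 0 according as i = j or not, the commutator of the sum with X_i has one
extra term [a, X_i], which lowers n + 1 to n. -/
theorem Relations.ad_euler (n : ℕ) (a : A) (i : ι) :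
    ad X i (((n + 1 : ℕ) : ℂ) • a - ∑ j, ad X j a * d j) =
      (n : ℂ) • ad X i a - ∑ j, ad X j (ad X i a) * d j := by
  simp only [map_sub, map_smul, map_sum, ad_mul, h.ad_d, Finset.sum_add_distrib, mul_ite, mul_one,
    mul_zero, Finset.sum_ite_eq, Finset.mem_univ, if_true, ad_comm X h.comm_X i]
  push_cast
  rw [add_smul, one_smul]
  abel

/-- Euler's formula: on symbols, the sum of [a, X_j] d_j is the Euler operator and multiplies the
part of degree n by n. The difference thus loses its top-order part. -/
theorem Relations.isOrdLT_euler {n : ℕ} {a : A} (ha : IsOrdLT X (n + 1) a) :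
    IsOrdLT X n ((n : ℂ) • a - ∑ j, ad X j a * d j) := by
  induction n generalizing a with
  | zero =>
    have h0 : ∀ i, ad X i a = 0 := ha
    simp [IsOrdLT, h0]
  | succ n ih =>
    intro i
    rw [h.ad_euler]
    exact ih (ha i)

/-- A subalgebra that contains the commutant of the `X i` and the `d i` contains all elements of
finite order. -/
theorem Relations.mem_of_isOrdLT (S : Subalgebra ℂ A) (h1 : ∀ a, (∀ i, ad X i a = 0) → a ∈ S)
    (h2 : ∀ i, d i ∈ S) {n : ℕ} {a : A} (ha : IsOrdLT X n a) : a ∈ S := by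
  induction n generalizing a with
  | zero => rw [show a = 0 from ha]; exact S.zero_mem
  | succ n ih =>
    -- For n = 0 the element has order < 1, so it lies in the commutant; Euler's formula is useless
    -- there, since it would require dividing by 0.
    rcases Nat.eq_zero_or_pos n with rfl | hn
    · exact h1 a ha
    have hs : (n : ℂ) • a ∈ S := by
      rw [← sub_add_cancel ((n : ℂ) • a) (∑ j, ad X j a * d j)]
      exact S.add_mem (ih (h.isOrdLT_euler ha))
        (S.sum_mem fun j _ => S.mul_mem (ih (ha j)) (h2 j))
    have := S.smul_mem hs (n : ℂ)⁻¹
    rwa [smul_smul, inv_mul_cancel₀ (Nat.cast_ne_zero.2 hn.ne'), one_smul] at this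

end Euler

end

theorem Relations.ad_eq_pderiv {X d : ι → A} [DecidableEq ι] (h : Relations X d)
    {τ : MvPolynomial ι ℂ →ₐ[ℂ] A} (hτ : ∀ i, τ (MvPolynomial.X i) = d i) (i : ι)
    (s : MvPolynomial ι ℂ) : ad X i (τ s) = τ (MvPolynomial.pderiv i s) := by
  induction s using MvPolynomial.induction_on with
  | C c =>
    rw [MvPolynomial.pderiv_C, map_zero, ad_apply, ← MvPolynomial.algebraMap_eq, AlgHom.commutes,
      Algebra.commutes, sub_self]
  | add p q hp hq => rw [map_add, map_add, hp, hq, map_add, map_add]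
  | mul_X p j hp =>
    rw [map_mul, hτ, ad_mul, hp, h.ad_d, MvPolynomial.pderiv_mul, map_add, map_mul, hτ, map_mul,
      MvPolynomial.pderiv_X]
    congr 2
    rcases eq_or_ne i j with rfl | hij
    · simp
    · simp [hij]

/-! ### Symbols of normally ordered operators. -/

theorem exists_eq_add_single {β : ι →₀ ℕ} (hβ : β ≠ 0) : ∃ i γ, β = γ + Finsupp.single i 1 := by
  classical
  obtain ⟨i, hi⟩ := Finsupp.ne_iff.1 hβ
  refine ⟨i, β - Finsupp.single i 1, (tsub_add_cancel_of_le ?_).symm⟩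
  rw [Finsupp.single_le_iff]
  exact Nat.one_le_iff_ne_zero.2 hi

theorem coeff_add_single_eq_zero {R : Type*} [CommRing R] [CharZero R] [IsDomain R]
    {p : MvPolynomial ι R} {i : ι} {γ : ι →₀ ℕ}
    (h : (MvPolynomial.pderiv i p).coeff γ = 0) : p.coeff (γ + Finsupp.single i 1) = 0 := by
  rw [MvPolynomial.coeff_pderiv] at h
  refine (mul_eq_zero.1 h).resolve_right ?_
  exact_mod_cast Nat.succ_ne_zero (γ i)

theorem coeff_eq_zero_of_pderiv {R : Type*} [CommRing R] [CharZero R] [IsDomain R]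
    {p : MvPolynomial ι R} (h : ∀ i, MvPolynomial.pderiv i p = 0) {β : ι →₀ ℕ} (hβ : β ≠ 0) :
    p.coeff β = 0 := by
  obtain ⟨i, γ, rfl⟩ := exists_eq_add_single hβ
  exact coeff_add_single_eq_zero (by rw [h, MvPolynomial.coeff_zero])

/-- Polynomials with coefficients in `R` on the left, evaluated at commuting elements. -/
def leftEval {R : Type*} [CommRing R] (f : R →+* A) (τ : MvPolynomial ι ℂ →ₐ[ℂ] A) :
    MvPolynomial ι R →+ A :=
  (Finsupp.liftAddHom fun β => (AddMonoidHom.mulRight (τ (MvPolynomial.monomial β 1))).comp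
    f.toAddMonoidHom).comp (MvPolynomial.basisMonomials ι R).repr.toLinearMap.toAddMonoidHom

section

variable {R : Type*} [CommRing R] (f : R →+* A) (τ : MvPolynomial ι ℂ →ₐ[ℂ] A)

theorem leftEval_monomial (β : ι →₀ ℕ) (r : R) :
    leftEval f τ (MvPolynomial.monomial β r) = f r * τ (MvPolynomial.monomial β 1) := by
  have : MvPolynomial.monomial β r = r • (MvPolynomial.basisMonomials ι R) β := by
    rw [MvPolynomial.coe_basisMonomials, MvPolynomial.smul_monomial, smul_eq_mul, mul_one]
  rw [this, leftEval, AddMonoidHom.comp_apply]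
  change Finsupp.liftAddHom _ ((MvPolynomial.basisMonomials ι R).repr (r • _)) = _
  rw [map_smul, Module.Basis.repr_self, Finsupp.smul_single, Finsupp.liftAddHom_apply_single,
    smul_eq_mul, mul_one]
  rfl

theorem leftEval_eq_sum (p : MvPolynomial ι R) :
    leftEval f τ p = ∑ β ∈ p.support, f (p.coeff β) * τ (MvPolynomial.monomial β 1) := by
  conv_lhs => rw [p.as_sum, map_sum]
  simp only [leftEval_monomial]

theorem leftEval_C_mul (r : R) (p : MvPolynomial ι R) :
    leftEval f τ (MvPolynomial.C r * p) = f r * leftEval f τ p := by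
  induction p using MvPolynomial.induction_on' with
  | monomial β s =>
    rw [MvPolynomial.C_mul_monomial, leftEval_monomial, leftEval_monomial, f.map_mul, mul_assoc]
  | add p q hp hq => rw [mul_add, map_add, map_add, hp, hq, mul_add]

theorem map_leftEval {B : Type*} [Ring B] [Algebra ℂ B] {S : Type*} [CommRing S] (g : A →ₐ[ℂ] B)
    (f' : S →+* B) (φ : R →+* S) (h : ∀ r, g (f r) = f' (φ r)) (p : MvPolynomial ι R) :
    g (leftEval f τ p) = leftEval f' (g.comp τ) (MvPolynomial.map φ p) := by
  induction p using MvPolynomial.induction_on' with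
  | monomial β s =>
    rw [leftEval_monomial, MvPolynomial.map_monomial, leftEval_monomial, map_mul, h]
    rfl
  | add p q hp hq => rw [map_add, map_add, map_add, map_add, hp, hq]

theorem leftEval_map (φ : ℂ →+* R) (h : ∀ c, f (φ c) = algebraMap ℂ A c) (q : MvPolynomial ι ℂ) :
    leftEval f τ (MvPolynomial.map φ q) = τ q := by
  induction q using MvPolynomial.induction_on' with
  | monomial β c =>
    rw [MvPolynomial.map_monomial, leftEval_monomial, h, ← Algebra.smul_def, ← map_smul,
      MvPolynomial.smul_monomial, smul_eq_mul, mul_one]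
  | add p q hp hq => rw [map_add, map_add, map_add, hp, hq]

variable {X} (hX : ∀ i s, ad X i (τ s) = τ (MvPolynomial.pderiv i s))
  (hf : ∀ i r, ad X i (f r) = 0)

include hX hf

/-- The coefficients commute with X_i, so the commutator acts only on the right-hand factor, as a
partial derivative of the symbol. -/
theorem ad_leftEval (i : ι) (p : MvPolynomial ι R) :
    ad X i (leftEval f τ p) = leftEval f τ (MvPolynomial.pderiv i p) := by
  induction p using MvPolynomial.induction_on' with
  | monomial β r =>
    rw [leftEval_monomial, ad_mul, hf, zero_mul, zero_add, hX, MvPolynomial.pderiv_monomial,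
      MvPolynomial.pderiv_monomial, leftEval_monomial, f.map_mul, one_mul, mul_assoc]
    congr 1
    have : MvPolynomial.monomial (β - Finsupp.single i 1) ((β i : ℕ) : ℂ) =
        (β i) • MvPolynomial.monomial (β - Finsupp.single i 1) (1 : ℂ) := by
      rw [MvPolynomial.smul_monomial, nsmul_eq_mul, mul_one]
    rw [this, map_nsmul, map_natCast, nsmul_eq_mul]
  | add p q hp hq => rw [map_add, map_add, hp, hq, map_add, map_add]

/-- Induction on a degree bound. The kernel is stable under partial derivatives by `ad_leftEval`; if
all of them vanish, the symbol is constant in characteristic 0, and injectivity of `f` finishes. -/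
theorem leftEval_injective [CharZero R] [IsDomain R] (hinj : Function.Injective f) :
    Function.Injective (leftEval (ι := ι) f τ) := by
  have key : ∀ (n : ℕ) (p : MvPolynomial ι R),
      (∀ β : ι →₀ ℕ, n ≤ β.degree → p.coeff β = 0) → leftEval f τ p = 0 → p = 0 := by
    intro n
    induction n with
    | zero =>
      intro p hp _
      ext β
      exact hp β (Nat.zero_le _)
    | succ n ih =>
      intro p hp h0
      have hd : ∀ i, MvPolynomial.pderiv i p = 0 := fun i => by
        refine ih _ (fun β hβ => ?_) ?_
        · rw [MvPolynomial.coeff_pderiv, hp _ (by simpa using hβ), zero_mul]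
        · rw [← ad_leftEval f τ hX hf, h0, map_zero]
      have hC : p = MvPolynomial.C (p.coeff 0) := by
        classical
        ext β
        rw [MvPolynomial.coeff_C]
        split_ifs with hβ
        · rw [hβ]
        · exact coeff_eq_zero_of_pderiv hd (Ne.symm hβ)
      rw [hC, MvPolynomial.C_apply, leftEval_monomial, MvPolynomial.monomial_zero', map_one, map_one,
        mul_one] at h0
      rw [hC, hinj (h0.trans (map_zero f).symm), map_zero]
  refine (injective_iff_map_eq_zero _).2 fun p hp => key (p.totalDegree + 1) p (fun β hβ => ?_) hp
  refine MvPolynomial.coeff_eq_zero_of_totalDegree_lt ?_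
  rw [← Finsupp.degree_apply]
  omega

/-- The order of a polynomial differential operator is its degree. -/
theorem coeff_eq_zero_of_isOrdLT [CharZero R] [IsDomain R] (hinj : Function.Injective f) {n : ℕ}
    {p : MvPolynomial ι R} (hp : IsOrdLT X n (leftEval f τ p)) {β : ι →₀ ℕ} (hβ : n ≤ β.degree) :
    p.coeff β = 0 := by
  induction n generalizing p β with
  | zero =>
    rw [leftEval_injective f τ hX hf hinj (hp.trans (map_zero _).symm), MvPolynomial.coeff_zero]
  | succ n ih =>
    obtain ⟨i, γ, rfl⟩ := exists_eq_add_single (β := β) (by rintro rfl; simp at hβ)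
    refine coeff_add_single_eq_zero (ih (p := MvPolynomial.pderiv i p) ?_ (by simpa using hβ))
    rw [← ad_leftEval f τ hX hf]
    exact hp i

end

end WeylPair
end

noncomputable section

namespace ReflectionPair

variable {V : Type*} [AddCommGroup V] [Module ℂ V] (D : ReflectionPair V)

attribute [local instance 10] ringDXSkew

/-! ### The Dunkl representation -/

/-- The image in `ℂ[X]` of a linear form, linearly. -/
def coordLinear : Module.Dual ℂ V →ₗ[ℂ] D.CX where
  toFun := D.coord
  map_add' := D.coord_add
  map_smul' := D.coord_smul

theorem coordLinear_apply (x : Module.Dual ℂ V) : D.coordLinear x = D.coord x := rfl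

/-- The algebra map `T(V ⊕ V*) → 𝒟(X) ⋊ N` that sends `y` to `T_y` and `x` to `x`. -/
def tensorToDXSkew : TensorAlgebra ℂ (V × Module.Dual ℂ V) →ₐ[ℂ] D.DXSkew :=
  TensorAlgebra.lift ℂ (D.dunklLinear.coprod (D.fnHom.toLinearMap ∘ₗ D.coordLinear))

theorem tensorToDXSkew_ι (u : V × Module.Dual ℂ V) :
    D.tensorToDXSkew (TensorAlgebra.ι ℂ u) = D.dunkl u.1 + D.fnHom (D.coord u.2) := by
  rw [tensorToDXSkew, TensorAlgebra.lift_ι_apply]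
  rfl

/-- This covariance is what allows the map on T(V ⊕ V*) and the embedding of N to be glued on the
skew group algebra. -/
theorem tensorToDXSkew_smul (w : D.N) (t : TensorAlgebra ℂ (V × Module.Dual ℂ V)) :
    D.tensorToDXSkew (w • t) * D.gp w = D.gp w * D.tensorToDXSkew t := by
  change D.tensorToDXSkew (tensorAct (w : V ≃ₗ[ℂ] V) t) * D.gp w = _
  induction t using TensorAlgebra.induction with
  | algebraMap c => rw [AlgHom.commutes, AlgHom.commutes, Algebra.commutes]
  | ι u =>
    rw [tensorAct_ι, tensorToDXSkew_ι, tensorToDXSkew_ι, mul_add, add_mul, gp_mul_dunkl,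
      gp_mul_fnHom, act_coord]
  | mul s t hs ht => rw [map_mul, map_mul, map_mul, mul_assoc, ht, ← mul_assoc, hs, mul_assoc]
  | add s t hs ht => rw [map_add, map_add, map_add, add_mul, mul_add, hs, ht]

/-- The algebra map `T(V ⊕ V*) ⋊ N → 𝒟(X) ⋊ N` that sends `y` to `T_y` and `x` to `x`. -/
def tensorSkewToDXSkew : D.TensorSkew →ₐ[ℂ] D.DXSkew :=
  SkewMonoidAlgebra.liftNCAlgHom (k := ℂ) D.tensorToDXSkew D.gp
    (fun {t w} => D.tensorToDXSkew_smul w t)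

theorem tensorSkewToDXSkew_single (w : D.N) (t : TensorAlgebra ℂ (V × Module.Dual ℂ V)) :
    D.tensorSkewToDXSkew (SkewMonoidAlgebra.single w t) = D.tensorToDXSkew t * D.gp w :=
  SkewMonoidAlgebra.liftNC_single _ _ _ _

theorem tensorSkewToDXSkew_of (w : D.N) :
    D.tensorSkewToDXSkew (SkewMonoidAlgebra.of _ _ w) = D.gp w := by
  rw [SkewMonoidAlgebra.of_apply, tensorSkewToDXSkew_single, map_one, one_mul]

theorem tensorSkewToDXSkew_tensX (x : Module.Dual ℂ V) :
    D.tensorSkewToDXSkew (D.tensX x) = D.fnHom (D.coord x) := by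
  rw [tensX, tensorSkewToDXSkew_single, tensorToDXSkew_ι, map_one, mul_one, ← dunklLinear_apply,
    map_zero, zero_add]

theorem tensorSkewToDXSkew_tensY (y : V) : D.tensorSkewToDXSkew (D.tensY y) = D.dunkl y := by
  rw [tensY, tensorSkewToDXSkew_single, tensorToDXSkew_ι, map_one, mul_one, ← coordLinear_apply,
    map_zero, map_zero, add_zero]

theorem tensorSkewToDXSkew_tensGroup (a : MonoidAlgebra ℂ D.N) :
    D.tensorSkewToDXSkew (D.tensGroup a) = D.groupToDXSkew a := by
  have : D.tensorSkewToDXSkew.comp D.tensGroup = D.groupToDXSkew := by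
    apply MonoidAlgebra.algHom_ext
    · intro w
      change D.tensorSkewToDXSkew (D.tensGroup (MonoidAlgebra.of ℂ D.N w)) =
        D.groupToDXSkew (MonoidAlgebra.of ℂ D.N w)
      rw [groupToDXSkew_of, tensGroup, MonoidAlgebra.lift_of, tensorSkewToDXSkew_of]
    · exact Subsingleton.elim _ _
  exact congrArg (fun φ => φ a) this

theorem tensorSkewToDXSkew_rel [FiniteDimensional ℂ V] ⦃s t : D.TensorSkew⦄ (h : D.Rel s t) :
    D.tensorSkewToDXSkew s = D.tensorSkewToDXSkew t := by
  cases h with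
  | xx x x' =>
    rw [map_sub, map_mul, map_mul, map_zero, tensorSkewToDXSkew_tensX, tensorSkewToDXSkew_tensX,
      ← map_mul, ← map_mul, mul_comm, sub_self]
  | yy y y' =>
    rw [map_sub, map_mul, map_mul, map_zero, tensorSkewToDXSkew_tensY, tensorSkewToDXSkew_tensY,
      dunkl_comm, sub_self]
  | yx y x =>
    rw [map_sub, map_mul, map_mul, tensorSkewToDXSkew_tensX, tensorSkewToDXSkew_tensY,
      dunkl_mul_coord, map_add, AlgHom.commutes, map_sum]
    congr 1
    exact Finset.sum_congr rfl fun H _ => by rw [map_smul, tensorSkewToDXSkew_tensGroup]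

/-- The Dunkl representation `Φ : A(W₀, W) → 𝒟(X) ⋊ N`. -/
def dunklRep [FiniteDimensional ℂ V] : D.Cherednik →ₐ[ℂ] D.DXSkew :=
  RingQuot.liftAlgHom ℂ ⟨D.tensorSkewToDXSkew, D.tensorSkewToDXSkew_rel⟩

section

variable [FiniteDimensional ℂ V]

theorem dunklRep_toCherednik (t : D.TensorSkew) :
    D.dunklRep (D.toCherednik t) = D.tensorSkewToDXSkew t :=
  RingQuot.liftAlgHom_mkAlgHom_apply ℂ D.tensorSkewToDXSkew D.tensorSkewToDXSkew_rel t

theorem dunklRep_genX (x : Module.Dual ℂ V) : D.dunklRep (D.genX x) = D.fnHom (D.coord x) := by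
  rw [genX, dunklRep_toCherednik, tensorSkewToDXSkew_tensX]

theorem dunklRep_genY (y : V) : D.dunklRep (D.genY y) = D.dunkl y := by
  rw [genY, dunklRep_toCherednik, tensorSkewToDXSkew_tensY]

theorem dunklRep_genN (w : D.N) : D.dunklRep (D.genN w) = D.gp w := by
  rw [genN, dunklRep_toCherednik, tensorSkewToDXSkew_of]

theorem dunklRep_polyToCherednik (p : PolyFun V) :
    D.dunklRep (D.polyToCherednik p) = D.fnHom (algebraMap (PolyFun V) D.CX p) := by
  induction p using SymmetricAlgebra.induction with
  | algebraMap c =>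
    rw [AlgHom.commutes, AlgHom.commutes, ← IsScalarTower.algebraMap_apply ℂ (PolyFun V) D.CX,
      AlgHom.commutes]
  | ι x => rw [polyToCherednik_ι, dunklRep_genX]; rfl
  | mul p q hp hq => rw [map_mul, map_mul, RingHom.map_mul, map_mul, hp, hq]
  | add p q hp hq => rw [map_add, map_add, RingHom.map_add, map_add, hp, hq]

theorem dunklRep_smul (p : PolyFun V) (a : D.Cherednik) :
    D.dunklRep (p • a) = D.fnHom (algebraMap (PolyFun V) D.CX p) * D.dunklRep a := by
  rw [← dunklRep_polyToCherednik, ← map_mul]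
  rfl

end

/-! ### Generators of the algebra of differential operators -/

/-- The coordinates attached to a basis, as differential operators. -/
def coordOps {ι : Type*} (b : Module.Basis ι ℂ V) (i : ι) : D.DX :=
  functionOp D.CX (D.coord (b.coord i))

/-- The derivatives along the vectors of a basis, as differential operators. -/
def partialOps {ι : Type*} (b : Module.Basis ι ℂ V) (i : ι) : D.DX := D.partialOp (b i)

theorem opHom_injective : Function.Injective D.opHom := SkewMonoidAlgebra.single_injective 1

section

variable {ι : Type*} (b : Module.Basis ι ℂ V)

theorem weylRelations [DecidableEq ι] :
    WeylPair.Relations (D.coordOps b) (D.partialOps b) where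
  comm_X i j := by rw [coordOps, coordOps, ← map_mul, mul_comm, map_mul]
  ad_d i j := by
    refine WeylPair.ad_eq_of_mul_eq _ ((D.partialOp_mul_functionOp _ _).trans ?_)
    rw [partialDeriv_coord, AlgHom.commutes, Module.Basis.coord_apply, Module.Basis.repr_self,
      Finsupp.single_apply]
    congr 1
    by_cases h : i = j <;> simp [h, Ne.symm]

theorem ad_functionOp (i : ι) (f : D.CX) :
    WeylPair.ad (D.coordOps b) i (functionOp D.CX f) = 0 := by
  rw [WeylPair.ad_apply, coordOps, ← map_mul, ← map_mul, mul_comm, sub_self]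

/-- Only commutators with the coordinates are retained from Grothendieck's definition. The index n +
1 appears because `IsOrdLT` is a strict bound. -/
theorem isOrdLT_of_isDiffOp {n : ℕ} {θ : D.DX} (h : IsDiffOp D.CX n θ.1) :
    WeylPair.IsOrdLT (D.coordOps b) (n + 1) θ := by
  induction n generalizing θ with
  | zero => exact fun i => Subtype.ext (h (D.coord (b.coord i)))
  | succ n ih => exact fun i => ih (h (D.coord (b.coord i)))

/-- Commuting with the coordinates of a basis means commuting with all linear forms, so the
commutant theorem in 𝒟(X) ⋊ N applies to the image of θ. -/
theorem exists_functionOp_of_ad [Fintype ι] {θ : D.DX}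
    (h : ∀ i, WeylPair.ad (D.coordOps b) i θ = 0) : ∃ f, θ = functionOp D.CX f := by
  refine ⟨D.rep (D.opHom θ) 1, D.opHom_injective (D.eq_fnHom_of_commute fun x => ?_)⟩
  have hi : ∀ i, D.opHom θ * D.fnHom (D.coord (b.coord i)) =
      D.fnHom (D.coord (b.coord i)) * D.opHom θ := fun i => by
    have := congrArg D.opHom (sub_eq_zero.1 (h i))
    exact (map_mul D.opHom _ _).symm.trans (this.trans (map_mul D.opHom _ _))
  have hx : ∑ i, x (b i) • b.coord i = x := b.ext fun j => by simp
  rw [← hx, ← coordLinear_apply, map_sum, map_sum, Finset.mul_sum, Finset.sum_mul]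
  refine Finset.sum_congr rfl fun i _ => ?_
  rw [map_smul, map_smul, mul_smul_comm, smul_mul_assoc, coordLinear_apply, hi]

end

/-- `𝒟(X)` is generated by the functions and the directional derivatives. -/
theorem subalgebra_DX_eq_top [FiniteDimensional ℂ V] (S : Subalgebra ℂ D.DX)
    (h1 : ∀ f, functionOp D.CX f ∈ S) (h2 : ∀ y, D.partialOp y ∈ S) : S = ⊤ := by
  let b := Module.finBasis ℂ V
  refine Algebra.eq_top_iff.2 fun θ => ?_
  obtain ⟨n, hn⟩ := θ.2
  refine (D.weylRelations b).mem_of_isOrdLT S (fun a ha => ?_) (fun i => h2 (b i))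
    (D.isOrdLT_of_isDiffOp b hn)
  obtain ⟨f, rfl⟩ := D.exists_functionOp_of_ad b ha
  exact h1 f

end ReflectionPair
end

noncomputable section

/-! ### Orders of differential operators -/

section DiffOpLT

variable {R : Type*} [CommRing R] [Algebra ℂ R]

/-- Differential operators of order `< n`. -/
def IsDiffOpLT : ℕ → Module.End ℂ R → Prop
  | 0, θ => θ = 0
  | n + 1, θ => IsDiffOp R n θ

theorem isDiffOp_derivation (d : Derivation ℂ R R) : IsDiffOp R 1 (d : R →ₗ[ℂ] R) := by
  intro f g
  ext u
  simp only [Module.End.mul_apply, LinearMap.sub_apply, LinearMap.mulLeft_apply,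
    Derivation.coeFn_coe, Derivation.leibniz, smul_eq_mul, LinearMap.zero_apply]
  ring

theorem IsDiffOpLT.zero (n : ℕ) : IsDiffOpLT n (0 : Module.End ℂ R) := by
  cases n with
  | zero => rfl
  | succ n => exact IsDiffOp.zero n

theorem IsDiffOpLT.add {n : ℕ} {θ η : Module.End ℂ R} (h : IsDiffOpLT n θ) (h' : IsDiffOpLT n η) :
    IsDiffOpLT n (θ + η) := by
  cases n with
  | zero => rw [show θ = 0 from h, show η = 0 from h', add_zero]; rfl
  | succ n => exact IsDiffOp.add h h'

theorem IsDiffOpLT.mono {m n : ℕ} (hmn : m ≤ n) {θ : Module.End ℂ R} (h : IsDiffOpLT m θ) :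
    IsDiffOpLT n θ := by
  cases m with
  | zero => rw [show θ = 0 from h]; exact IsDiffOpLT.zero n
  | succ m =>
    cases n with
    | zero => omega
    | succ n => exact IsDiffOp.mono (Nat.le_of_succ_le_succ hmn) h

theorem IsDiffOp.mul_lt {m n : ℕ} {θ η : Module.End ℂ R} (h : IsDiffOp R m θ)
    (h' : IsDiffOpLT n η) : IsDiffOpLT (m + n) (θ * η) := by
  cases n with
  | zero => rw [show η = 0 from h', mul_zero]; exact IsDiffOpLT.zero _
  | succ n => exact IsDiffOp.mul h h'

theorem IsDiffOpLT.of_add_eq_zero {n : ℕ} {θ η : Module.End ℂ R} (h : θ + η = 0)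
    (h' : IsDiffOpLT n η) : IsDiffOpLT n θ := by
  have : θ = LinearMap.mulLeft ℂ (-1 : R) * η := by
    rw [eq_neg_of_add_eq_zero_left h]
    ext u
    simp
  rw [this, ← Nat.zero_add n]
  exact (isDiffOp_mulLeft (-1 : R)).mul_lt h'

theorem IsDiffOpLT.sum {n : ℕ} {κ : Type*} (s : Finset κ) (θ : κ → diffOps R)
    (h : ∀ i ∈ s, IsDiffOpLT n (θ i).1) : IsDiffOpLT n (∑ i ∈ s, θ i).1 := by
  classical
  induction s using Finset.induction_on with
  | empty => exact IsDiffOpLT.zero n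
  | insert i s hi ih =>
    rw [Finset.sum_insert hi]
    exact (h i (Finset.mem_insert_self i s)).add
      (ih fun j hj => h j (Finset.mem_insert_of_mem hj))

end DiffOpLT

namespace ReflectionPair

variable {V : Type*} [AddCommGroup V] [Module ℂ V] (D : ReflectionPair V)

theorem isDiffOpLT_smul (w : D.N) {n : ℕ} {θ : D.DX} (h : IsDiffOpLT n θ.1) :
    IsDiffOpLT n (w • θ).1 := by
  cases n with
  | zero =>
    have : θ = 0 := Subtype.ext h
    rw [this, smul_zero]
    rfl
  | succ n => exact IsDiffOp.conj (D.act w) h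

/-- Elements of `𝒟(X) ⋊ N` whose coefficients have order `< n`. -/
def IsLow (n : ℕ) (P : D.DXSkew) : Prop := ∀ w, IsDiffOpLT n (P.coeff w).1

variable {D}

theorem IsLow.zero (n : ℕ) : D.IsLow n 0 := fun _ => IsDiffOpLT.zero n

theorem IsLow.add {n : ℕ} {P Q : D.DXSkew} (h : D.IsLow n P) (h' : D.IsLow n Q) :
    D.IsLow n (P + Q) := fun w => by
  have : (P + Q).coeff w = P.coeff w + Q.coeff w := by
    rw [SkewMonoidAlgebra.coeff_add, Finsupp.add_apply]
  rw [this]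
  exact (h w).add (h' w)

theorem IsLow.mono {m n : ℕ} (hmn : m ≤ n) {P : D.DXSkew} (h : D.IsLow m P) : D.IsLow n P :=
  fun w => (h w).mono hmn

theorem IsLow.sum {n : ℕ} {κ : Type*} (s : Finset κ) (P : κ → D.DXSkew)
    (h : ∀ i ∈ s, D.IsLow n (P i)) : D.IsLow n (∑ i ∈ s, P i) := by
  classical
  induction s using Finset.induction_on with
  | empty => exact IsLow.zero n
  | insert i s hi ih =>
    rw [Finset.sum_insert hi]
    exact (h i (Finset.mem_insert_self i s)).add
      (ih fun j hj => h j (Finset.mem_insert_of_mem hj))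

/-- The coefficients of the product are sums of terms P_w · (w • Q_u), and the action of w preserves
order. The bound on P is order ≤ m, hence the asymmetric indices. -/
theorem IsLow.mul {m n : ℕ} {P Q : D.DXSkew} (h : D.IsLow (m + 1) P) (h' : D.IsLow n Q) :
    D.IsLow (m + n) (P * Q) := by
  intro x
  rw [SkewMonoidAlgebra.coeff_mul_left, SkewMonoidAlgebra.sum_def, Finsupp.sum]
  exact IsDiffOpLT.sum _ _ fun w _ => (h w).mul_lt (D.isDiffOpLT_smul w (h' _))

theorem coeff_sum_single [Fintype D.N] (q : D.N → D.DX) (u : D.N) :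
    (∑ w, SkewMonoidAlgebra.single w (q w) : D.DXSkew).coeff u = q u := by
  classical
  have : (∑ w, SkewMonoidAlgebra.single w (q w) : D.DXSkew).coeff =
      ∑ w, Finsupp.single w (q w) := map_sum SkewMonoidAlgebra.coeffAddEquiv _ _
  rw [this, Finsupp.finsetSum_apply]
  simp [Finsupp.single_apply]

theorem isLow_single (w : D.N) {n : ℕ} {θ : D.DX} (h : IsDiffOpLT n θ.1) :
    D.IsLow n (SkewMonoidAlgebra.single w θ) := by
  classical
  intro u
  rw [SkewMonoidAlgebra.coeff_single_apply]
  split_ifs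
  · exact h
  · exact IsDiffOpLT.zero n

variable (D)

theorem isLow_opHom {n : ℕ} {θ : D.DX} (h : IsDiffOpLT n θ.1) : D.IsLow n (D.opHom θ) :=
  isLow_single 1 h

theorem isLow_fnHom (f : D.CX) : D.IsLow 1 (D.fnHom f) := D.isLow_opHom (isDiffOp_mulLeft f)

theorem isLow_gp (w : D.N) : D.IsLow 1 (D.gp w) :=
  isLow_single w (isDiffOp_mulLeft (1 : D.CX) |> fun h => by
    rwa [show LinearMap.mulLeft ℂ (1 : D.CX) = ((1 : D.DX) : Module.End ℂ D.CX) from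
      LinearMap.mulLeft_one ℂ _] at h)

variable {D} in
theorem IsLow.mul_gp {n : ℕ} {P : D.DXSkew} (h : D.IsLow n P) (w : D.N) : D.IsLow n (P * D.gp w) := by
  cases n with
  | zero =>
    have : P = 0 := SkewMonoidAlgebra.ext fun u => Subtype.ext (h u)
    rw [this, zero_mul]
    exact IsLow.zero 0
  | succ n => exact IsLow.mul h (D.isLow_gp w)

theorem isLow_smul (c : ℂ) {n : ℕ} {P : D.DXSkew} (h : D.IsLow n P) : D.IsLow n (c • P) := by
  rw [Algebra.smul_def, ← D.fnHom.commutes, ← Nat.zero_add n]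
  exact IsLow.mul (D.isLow_fnHom _) h

/-- The part of T_y supported on the stabilisers has functions as coefficients, that is, order < 1.
-/
theorem exists_dunkl_eq (y : V) :
    ∃ B, D.IsLow 1 B ∧ D.dunkl y = D.opHom (D.partialOp y) + B := by
  refine ⟨_, ?_, D.dunkl_eq y⟩
  refine IsLow.sum _ _ fun H _ => D.isLow_smul _ (IsLow.mul (m := 0) (n := 1) (D.isLow_fnHom _) ?_)
  rw [groupToDXSkew_a]
  exact IsLow.sum _ _ fun w _ => D.isLow_smul _ (D.isLow_gp _)

/-! ### Leading terms of polynomials in the Dunkl operators. -/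

/-- The algebra map out of polynomials given by a linear map with commuting values. -/
def polyLift {A : Type*} [Ring A] [Algebra ℂ A] {ι : Type*} (b : Module.Basis ι ℂ V) (f : V →ₗ[ℂ] A)
    (hf : ∀ x x', f x * f x' = f x' * f x) : MvPolynomial ι ℂ →ₐ[ℂ] A :=
  (symLift f hf).comp (SymmetricAlgebra.equivMvPolynomial b).symm.toAlgHom

theorem polyLift_X {A : Type*} [Ring A] [Algebra ℂ A] {ι : Type*} (b : Module.Basis ι ℂ V)
    (f : V →ₗ[ℂ] A) (hf : ∀ x x', f x * f x' = f x' * f x) (i : ι) :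
    polyLift b f hf (MvPolynomial.X i) = f (b i) := by
  have : polyLift b f hf (MvPolynomial.X i) =
    symLift f hf ((SymmetricAlgebra.equivMvPolynomial b).symm (MvPolynomial.X i)) := rfl
  rw [this, SymmetricAlgebra.equivMvPolynomial_symm_X, symLift_ι]

attribute [local instance 10] ringDXSkew

variable {ι : Type*} (b : Module.Basis ι ℂ V)

/-- Polynomials in the Dunkl operators. -/
def dunklPoly [FiniteDimensional ℂ V] : MvPolynomial ι ℂ →ₐ[ℂ] D.DXSkew := polyLift (A := D.DXSkew) b D.dunklLinear D.dunkl_comm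

/-- Differential operators with constant coefficients. -/
def partialPoly : MvPolynomial ι ℂ →ₐ[ℂ] D.DX := polyLift (A := D.DX) b D.partialOp D.partialOp_comm

theorem dunklPoly_X [FiniteDimensional ℂ V] (i : ι) : D.dunklPoly b (MvPolynomial.X i) = D.dunkl (b i) :=
  polyLift_X _ _ _ i

theorem partialPoly_X (i : ι) : D.partialPoly b (MvPolynomial.X i) = D.partialOp (b i) :=
  polyLift_X _ _ _ i

theorem monomial_eq_mul (i : ι) (γ : ι →₀ ℕ) :
    MvPolynomial.monomial (γ + Finsupp.single i 1) (1 : ℂ) =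
      MvPolynomial.X i * MvPolynomial.monomial γ 1 := by
  rw [MvPolynomial.X, MvPolynomial.monomial_mul, one_mul, add_comm]

/-- Write T_i = ∂_i + B with B of order 0. In T_i T^γ the errors are B T^γ and ∂_i E, both of lower
order than ∂_i ∂^γ. The order bound on T^γ is carried along in the induction in order to control B
T^γ. -/
theorem isLow_dunklPoly [FiniteDimensional ℂ V] {n : ℕ} {β : ι →₀ ℕ} (hβ : β.degree = n) :
    D.IsLow (n + 1) (D.dunklPoly b (MvPolynomial.monomial β 1)) ∧
    ∃ E, D.IsLow n E ∧ D.dunklPoly b (MvPolynomial.monomial β 1) =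
      D.opHom (D.partialPoly b (MvPolynomial.monomial β 1)) + E := by
  induction n generalizing β with
  | zero =>
    have h0 : β = 0 := (Finsupp.degree_eq_zero_iff β).1 hβ
    rw [h0, MvPolynomial.monomial_zero', map_one, map_one, map_one, map_one]
    refine ⟨?_, 0, IsLow.zero 0, (add_zero _).symm⟩
    rw [← map_one D.fnHom]
    exact D.isLow_fnHom 1
  | succ n ih =>
    obtain ⟨i, γ, rfl⟩ := WeylPair.exists_eq_add_single (β := β) (by rintro rfl; simp at hβ)
    obtain ⟨h1, E, hE, h2⟩ := ih (β := γ) (by simpa using hβ)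
    obtain ⟨B, hB, hT⟩ := D.exists_dunkl_eq (b i)
    have hd : D.IsLow 2 (D.opHom (D.partialOp (b i))) :=
      D.isLow_opHom (isDiffOp_derivation (D.partialDeriv (b i)))
    rw [monomial_eq_mul, map_mul, map_mul, dunklPoly_X, partialPoly_X, map_mul]
    refine ⟨?_, B * D.dunklPoly b (MvPolynomial.monomial γ 1) +
      D.opHom (D.partialOp (b i)) * E, ?_, ?_⟩
    · rw [hT, show n + 1 + 1 = 1 + (n + 1) by omega]
      exact IsLow.mul (hd.add (hB.mono one_le_two)) h1
    · refine IsLow.add ?_ ?_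
      · have := IsLow.mul (m := 0) hB h1
        rwa [Nat.zero_add] at this
      · rw [Nat.add_comm n 1]
        exact IsLow.mul hd hE
    -- Only the factor following ∂_i is expanded; the one following B is folded back into T^γ.
    · conv_lhs => rw [hT, add_mul, h2, mul_add, ← h2]
      abel

/-- A polynomial in the Dunkl operators agrees to top order with the one in the derivatives. -/
theorem leftEval_dunklPoly [FiniteDimensional ℂ V] {n : ℕ} {p : MvPolynomial ι D.CX}
    (hp : ∀ β : ι →₀ ℕ, n + 1 ≤ β.degree → p.coeff β = 0) :
    ∃ E, D.IsLow n E ∧ WeylPair.leftEval D.fnHom.toRingHom (D.dunklPoly b) p =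
      D.opHom (WeylPair.leftEval (functionOp D.CX).toRingHom (D.partialPoly b) p) + E := by
  choose E hE h using fun β : ι →₀ ℕ => (D.isLow_dunklPoly b (rfl : β.degree = β.degree)).2
  refine ⟨∑ β ∈ p.support, D.fnHom (p.coeff β) * E β, ?_, ?_⟩
  · refine IsLow.sum _ _ fun β hβ => ?_
    have hn : β.degree ≤ n := by
      by_contra hlt
      exact MvPolynomial.mem_support_iff.1 hβ (hp β (by omega))
    have := IsLow.mul (m := 0) (D.isLow_fnHom (p.coeff β)) ((hE β).mono hn)
    rwa [Nat.zero_add] at this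
  · rw [WeylPair.leftEval_eq_sum, WeylPair.leftEval_eq_sum, map_sum, ← Finset.sum_add_distrib]
    refine Finset.sum_congr rfl fun β _ => ?_
    rw [h β, mul_add, map_mul]
    rfl

theorem isOrdLT_of_isDiffOpLT {n : ℕ} {θ : D.DX} (h : IsDiffOpLT n θ.1) :
    WeylPair.IsOrdLT (D.coordOps b) n θ := by
  cases n with
  | zero => exact Subtype.ext h
  | succ n => exact D.isOrdLT_of_isDiffOp b h

theorem functionOp_injective : Function.Injective (functionOp D.CX) := by
  intro f g h
  have h1 : f * 1 = g * 1 := congrArg (fun θ : D.DX => θ.1 1) h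
  rwa [mul_one, mul_one] at h1

theorem charZero_CX : CharZero D.CX :=
  charZero_of_injective_algebraMap (algebraMap ℂ D.CX).injective

/-- The monomials `T^β w` in the Dunkl operators and `N` are independent over `ℂ[X]`. -/
theorem eq_zero_of_sum_leftEval [FiniteDimensional ℂ V] [Fintype D.N] (p : D.N → MvPolynomial ι D.CX)
    (h : ∑ w, WeylPair.leftEval D.fnHom.toRingHom (D.dunklPoly b) (p w) * D.gp w = 0) : p = 0 := by
  classical
  -- Descent on a common strict degree bound for all the p_w: at each stage the coefficients of top
  -- degree are shown to vanish.
  have key : ∀ n : ℕ, (∀ w (β : ι →₀ ℕ), n ≤ β.degree → (p w).coeff β = 0) → p = 0 := by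
    intro n
    induction n with
    | zero =>
      intro hp
      ext w β
      exact hp w β (Nat.zero_le _)
    | succ n ih =>
      intro hp
      refine ih fun u β hβ => ?_
      choose E hE hEq using fun w => D.leftEval_dunklPoly b (hp w)
      simp only [hEq, add_mul, Finset.sum_add_distrib] at h
      have hcoeff := congrArg (fun P : D.DXSkew => P.coeff u) h
      have h1 : (∑ w, D.opHom (WeylPair.leftEval (functionOp D.CX).toRingHom (D.partialPoly b) (p w)) *
          D.gp w).coeff u =
          WeylPair.leftEval (functionOp D.CX).toRingHom (D.partialPoly b) (p u) := by
        simp only [coeff_opHom_mul_gp]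
        exact coeff_sum_single _ u
      have h2 : D.IsLow n (∑ w, E w * D.gp w) := IsLow.sum _ _ fun w _ => (hE w).mul_gp w
      have h3 : (∑ w, D.opHom (WeylPair.leftEval (functionOp D.CX).toRingHom (D.partialPoly b) (p w)) *
          D.gp w).coeff u + (∑ w, E w * D.gp w).coeff u = 0 := by
        rw [← Finsupp.add_apply, ← SkewMonoidAlgebra.coeff_add]
        exact hcoeff
      rw [h1] at h3
      have : CharZero D.CX := D.charZero_CX
      -- By `h3` the operator with symbol p_u is minus an operator of order < n, so its symbol has
      -- no coefficient in degrees ≥ n.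
      refine WeylPair.coeff_eq_zero_of_isOrdLT _ _
        ((D.weylRelations b).ad_eq_pderiv (D.partialPoly_X b)) (D.ad_functionOp b)
        D.functionOp_injective (D.isOrdLT_of_isDiffOpLT b ?_) hβ
      exact (h2 u).of_add_eq_zero (congrArg Subtype.val h3)
  refine key ((Finset.univ.sup fun w => (p w).totalDegree) + 1) fun w β hβ => ?_
  refine MvPolynomial.coeff_eq_zero_of_totalDegree_lt ?_
  rw [← Finsupp.degree_apply]
  have : (p w).totalDegree ≤ Finset.univ.sup fun w => (p w).totalDegree :=
    Finset.le_sup (f := fun w => (p w).totalDegree) (Finset.mem_univ w)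
  omega

end ReflectionPair
end

noncomputable section

namespace ReflectionPair

variable {V : Type*} [AddCommGroup V] [Module ℂ V] (D : ReflectionPair V)

/-! ### Generators and relations of the Cherednik algebra -/

theorem subalgebra_cherednik_eq_top (S : Subalgebra ℂ D.Cherednik) (hX : ∀ x, D.genX x ∈ S)
    (hY : ∀ y, D.genY y ∈ S) (hN : ∀ w, D.genN w ∈ S) : S = ⊤ := by
  refine Algebra.eq_top_iff.2 fun a => ?_
  obtain ⟨t, rfl⟩ : ∃ t, D.toCherednik t = a := RingQuot.mkAlgHom_surjective ℂ D.Rel a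
  have h1 : ∀ s : TensorAlgebra ℂ (V × Module.Dual ℂ V),
      D.toCherednik (SkewMonoidAlgebra.single 1 s) ∈ S := by
    intro s
    induction s using TensorAlgebra.induction with
    | algebraMap c =>
      have : (SkewMonoidAlgebra.single 1 (algebraMap ℂ _ c) : D.TensorSkew) = algebraMap ℂ _ c :=
        rfl
      rw [this, AlgHom.commutes]
      exact S.algebraMap_mem c
    | ι u =>
      have : TensorAlgebra.ι ℂ u = TensorAlgebra.ι ℂ (u.1, (0 : Module.Dual ℂ V)) +
          TensorAlgebra.ι ℂ ((0 : V), u.2) := by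
        rw [← map_add, Prod.mk_add_mk, add_zero, zero_add]
      rw [this, SkewMonoidAlgebra.single_add, map_add]
      exact S.add_mem (hY u.1) (hX u.2)
    | mul s t hs ht =>
      have : (SkewMonoidAlgebra.single 1 (s * t) : D.TensorSkew) =
          SkewMonoidAlgebra.single 1 s * SkewMonoidAlgebra.single 1 t := by
        rw [SkewMonoidAlgebra.single_mul_single, mul_one, one_smul]
      rw [this, map_mul]
      exact S.mul_mem hs ht
    | add s t hs ht =>
      rw [SkewMonoidAlgebra.single_add, map_add]
      exact S.add_mem hs ht
  induction t using SkewMonoidAlgebra.induction_on with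
  | zero => rw [map_zero]; exact S.zero_mem
  | single w s =>
    have : (SkewMonoidAlgebra.single w s : D.TensorSkew) =
        SkewMonoidAlgebra.single 1 s * SkewMonoidAlgebra.of _ _ w := by
      rw [SkewMonoidAlgebra.of_apply, SkewMonoidAlgebra.single_mul_single, one_mul, one_smul, mul_one]
    rw [this, map_mul]
    exact S.mul_mem (h1 s) (hN w)
  | add s t hs ht => rw [map_add]; exact S.add_mem hs ht

theorem genN_one : D.genN 1 = 1 := by rw [genN, map_one, map_one]

theorem genN_mul (w w' : D.N) : D.genN (w * w') = D.genN w * D.genN w' := by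
  rw [genN, map_mul, map_mul]
  rfl

theorem genN_mul_ι (w : D.N) (u : V × Module.Dual ℂ V) :
    D.genN w * D.toCherednik (SkewMonoidAlgebra.single 1 (TensorAlgebra.ι ℂ u)) =
      D.toCherednik (SkewMonoidAlgebra.single 1 (TensorAlgebra.ι ℂ
        ((w : V ≃ₗ[ℂ] V) u.1, dualAct (w : V ≃ₗ[ℂ] V) u.2))) * D.genN w := by
  rw [genN, ← map_mul, ← map_mul, SkewMonoidAlgebra.of_apply, SkewMonoidAlgebra.single_mul_single,
    SkewMonoidAlgebra.single_mul_single, one_mul, one_smul, one_mul, mul_one, mul_one, ← tensorAct_ι]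
  rfl

theorem genN_mul_genX (w : D.N) (x : Module.Dual ℂ V) :
    D.genN w * D.genX x = D.genX (dualAct (w : V ≃ₗ[ℂ] V) x) * D.genN w := by
  have := D.genN_mul_ι w (0, x)
  rwa [map_zero] at this

theorem genN_mul_genY (w : D.N) (y : V) :
    D.genN w * D.genY y = D.genY ((w : V ≃ₗ[ℂ] V) y) * D.genN w := by
  have := D.genN_mul_ι w (y, 0)
  rwa [map_zero] at this

theorem genN_mul_poly (w : D.N) (p : PolyFun V) :
    D.genN w * D.polyToCherednik p = D.polyToCherednik (polyAct (w : V ≃ₗ[ℂ] V) p) * D.genN w := by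
  induction p using SymmetricAlgebra.induction with
  | algebraMap c =>
    rw [AlgHom.commutes, AlgHom.commutes, AlgHom.commutes, Algebra.commutes]
  | ι x => rw [polyAct_ι, polyToCherednik_ι, polyToCherednik_ι, genN_mul_genX]
  | mul p q hp hq =>
    rw [map_mul, map_mul, map_mul, ← mul_assoc, hp, mul_assoc, hq, mul_assoc]
  | add p q hp hq => rw [map_add, map_add, map_add, mul_add, add_mul, hp, hq]

theorem toCherednik_tensGroup_mem (S : Subalgebra ℂ D.Cherednik) (hN : ∀ w, D.genN w ∈ S)
    (a : MonoidAlgebra ℂ D.N) : D.toCherednik (D.tensGroup a) ∈ S := by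
  induction a using MonoidAlgebra.induction_on with
  | of w =>
    have : D.tensGroup (MonoidAlgebra.of ℂ D.N w) = SkewMonoidAlgebra.of _ _ w :=
      MonoidAlgebra.lift_of _ _
    rw [this]
    exact hN w
  | add a b ha hb => rw [map_add, map_add]; exact S.add_mem ha hb
  | smul c a ha => rw [map_smul, map_smul]; exact S.smul_mem ha c

/-- The commutator of `y ∈ V` with a function is generated by functions and `N`. -/
theorem commutator_mem (S : Subalgebra ℂ D.Cherednik) (hX : ∀ x, D.genX x ∈ S)
    (hN : ∀ w, D.genN w ∈ S) (y : V) (p : PolyFun V) :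
    D.polyToCherednik p ∈ S ∧
      ∃ b ∈ S, D.genY y * D.polyToCherednik p = D.polyToCherednik p * D.genY y + b := by
  induction p using SymmetricAlgebra.induction with
  | algebraMap c =>
    rw [AlgHom.commutes]
    exact ⟨S.algebraMap_mem c, 0, S.zero_mem, by rw [add_zero, Algebra.commutes]⟩
  | ι x =>
    rw [polyToCherednik_ι]
    refine ⟨hX x, D.toCherednik (algebraMap ℂ D.TensorSkew (x y) + ∑ H ∈ D.hyperplanes₀,
      (D.α H y * x (D.v H) / D.α H (D.v H)) • D.tensGroup (D.γ H)), ?_, ?_⟩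
    rotate_left
    · have h := RingQuot.mkAlgHom_rel ℂ (Rel.yx (D := D) y x)
      change D.toCherednik _ = D.toCherednik _ at h
      rw [map_sub, map_mul, map_mul, sub_eq_iff_eq_add'] at h
      exact h
    · rw [map_add, AlgHom.commutes, map_sum]
      refine S.add_mem (S.algebraMap_mem _) (S.sum_mem fun H _ => ?_)
      rw [map_smul]
      exact S.smul_mem (D.toCherednik_tensGroup_mem S hN _) _
  | mul p q hp hq =>
    obtain ⟨hp, b, hb, h⟩ := hp
    obtain ⟨hq, c, hc, h'⟩ := hq
    rw [map_mul]
    -- Leibniz: [y, pq] = p[y, q] + [y, p]q. Membership of p and q in `S` is needed here, which is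
    -- why it is part of the induction.
    refine ⟨S.mul_mem hp hq, D.polyToCherednik p * c + b * D.polyToCherednik q,
      S.add_mem (S.mul_mem hp hc) (S.mul_mem hb hq), ?_⟩
    rw [← mul_assoc, h, add_mul, mul_assoc, h', mul_add, mul_assoc, add_assoc]
  | add p q hp hq =>
    obtain ⟨hp, b, hb, h⟩ := hp
    obtain ⟨hq, c, hc, h'⟩ := hq
    rw [map_add]
    refine ⟨S.add_mem hp hq, b + c, S.add_mem hb hc, ?_⟩
    rw [mul_add, h, h', add_mul]
    abel

theorem genY_comm (y y' : V) : D.genY y * D.genY y' = D.genY y' * D.genY y := by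
  have h := RingQuot.mkAlgHom_rel ℂ (Rel.yy (D := D) y y')
  rw [map_sub, map_mul, map_mul, map_zero, sub_eq_zero] at h
  exact h

/-- The generators `y ∈ V`, linearly. -/
def genYLinear : V →ₗ[ℂ] D.Cherednik where
  toFun := D.genY
  map_add' y y' := by
    have h : (y + y', (0 : Module.Dual ℂ V)) = (y, 0) + (y', 0) := by
      rw [Prod.mk_add_mk, add_zero]
    unfold genY tensY
    rw [h, map_add, SkewMonoidAlgebra.single_add, map_add]
  map_smul' c y := by
    have h : (c • y, (0 : Module.Dual ℂ V)) = c • (y, 0) := by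
      rw [Prod.smul_mk, smul_zero]
    unfold genY tensY
    rw [h, map_smul, ← SkewMonoidAlgebra.smul_single, map_smul, RingHom.id_apply]

/-- The algebra map `S(V) → A(W₀, W)`. -/
def symToCherednik : SymmetricAlgebra ℂ V →ₐ[ℂ] D.Cherednik := symLift D.genYLinear D.genY_comm

theorem symToCherednik_ι (y : V) : D.symToCherednik (SymmetricAlgebra.ι ℂ V y) = D.genY y :=
  symLift_ι _ _ y

theorem genN_mul_sym (w : D.N) (s : SymmetricAlgebra ℂ V) :
    ∃ s', D.genN w * D.symToCherednik s = D.symToCherednik s' * D.genN w := by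
  induction s using SymmetricAlgebra.induction with
  | algebraMap c => exact ⟨algebraMap ℂ _ c, by rw [AlgHom.commutes, Algebra.commutes]⟩
  | ι y => exact ⟨SymmetricAlgebra.ι ℂ V ((w : V ≃ₗ[ℂ] V) y), by
      rw [symToCherednik_ι, symToCherednik_ι, genN_mul_genY]⟩
  | mul s t hs ht =>
    obtain ⟨s', hs⟩ := hs
    obtain ⟨t', ht⟩ := ht
    exact ⟨s' * t', by rw [map_mul, map_mul, ← mul_assoc, hs, mul_assoc, ht, mul_assoc]⟩
  | add s t hs ht =>
    obtain ⟨s', hs⟩ := hs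
    obtain ⟨t', ht⟩ := ht
    exact ⟨s' + t', by rw [map_add, map_add, mul_add, hs, ht, add_mul]⟩

theorem poly_smul_def (p : PolyFun V) (a : D.Cherednik) : p • a = D.polyToCherednik p * a := rfl

/-- As a left module over `ℂ[V]`, the algebra `A(W₀, W)` is generated by the products of elements
of `S(V)` and of `N`. -/
theorem span_sym_genN : Submodule.span (PolyFun V)
    {a : D.Cherednik | ∃ s w, a = D.symToCherednik s * D.genN w} = ⊤ := by
  set U := Submodule.span (PolyFun V)
    {a : D.Cherednik | ∃ s w, a = D.symToCherednik s * D.genN w} with hU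
  -- The elements whose left multiplication preserves `U` form a subalgebra. Once it contains the
  -- generators it is everything, and 1 ∈ `U` gives the claim.
  let S : Subalgebra ℂ D.Cherednik :=
    { carrier := {a | ∀ u ∈ U, a * u ∈ U}
      mul_mem' := fun {a b} ha hb u hu => by
        rw [mul_assoc]
        exact ha _ (hb u hu)
      add_mem' := fun {a b} ha hb u hu => by
        rw [add_mul]
        exact U.add_mem (ha u hu) (hb u hu)
      algebraMap_mem' := fun c u hu => by
        rw [← D.polyToCherednik.commutes, ← poly_smul_def]
        exact U.smul_mem _ hu }
  have hX : ∀ x, D.genX x ∈ S := fun x u hu => by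
    rw [← polyToCherednik_ι, ← poly_smul_def]
    exact U.smul_mem _ hu
  have hN : ∀ w, D.genN w ∈ S := fun w u hu => by
    induction hu using Submodule.span_induction with
    | mem u hu =>
      obtain ⟨s, w', rfl⟩ := hu
      obtain ⟨s', hs⟩ := D.genN_mul_sym w s
      rw [← mul_assoc, hs, mul_assoc, ← genN_mul]
      exact Submodule.subset_span ⟨s', w * w', rfl⟩
    | zero => rw [mul_zero]; exact U.zero_mem
    | add u u' _ _ hu hu' => rw [mul_add]; exact U.add_mem hu hu'
    | smul p u _ hu =>
      rw [poly_smul_def, ← mul_assoc, genN_mul_poly, mul_assoc, ← poly_smul_def]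
      exact U.smul_mem _ hu
  have hY : ∀ y, D.genY y ∈ S := fun y u hu => by
    induction hu using Submodule.span_induction with
    | mem u hu =>
      obtain ⟨s, w, rfl⟩ := hu
      rw [← mul_assoc, ← symToCherednik_ι, ← map_mul]
      exact Submodule.subset_span ⟨_, w, rfl⟩
    | zero => rw [mul_zero]; exact U.zero_mem
    | add u u' _ _ hu hu' => rw [mul_add]; exact U.add_mem hu hu'
    | smul p u hmem hu =>
      -- Moving y past p costs an element generated by V* and N, already known to preserve `U`.
      obtain ⟨-, b, hb, h⟩ := D.commutator_mem S hX hN y p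
      rw [poly_smul_def, ← mul_assoc, h, add_mul, mul_assoc, ← poly_smul_def]
      exact U.add_mem (U.smul_mem _ hu) (hb u hmem)
  have hS := D.subalgebra_cherednik_eq_top S hX hY hN
  refine eq_top_iff.2 fun a _ => ?_
  have ha : a ∈ S := hS ▸ Algebra.mem_top
  have h1 : (1 : D.Cherednik) ∈ U :=
    Submodule.subset_span ⟨1, 1, by rw [map_one, genN_one, one_mul]⟩
  have := ha 1 h1
  rwa [mul_one] at this

/-! ### Injectivity of the Dunkl representation -/

section

variable {ι : Type*} (b : Module.Basis ι ℂ V)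

/-- Polynomials in the generators `y`. -/
def genYPoly : MvPolynomial ι ℂ →ₐ[ℂ] D.Cherednik := polyLift b D.genYLinear D.genY_comm

theorem genYPoly_X (i : ι) : D.genYPoly b (MvPolynomial.X i) = D.genY (b i) :=
  polyLift_X _ _ _ i

theorem genYPoly_equiv (s : SymmetricAlgebra ℂ V) :
    D.genYPoly b (SymmetricAlgebra.equivMvPolynomial b s) = D.symToCherednik s := by
  change D.symToCherednik ((SymmetricAlgebra.equivMvPolynomial b).symm _) = _
  rw [AlgEquiv.symm_apply_apply]

/-- The spanning half of the PBW theorem, in the normal order p(x) y^β w; independence comes from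
the Dunkl operators. -/
theorem exists_eq_sum_leftEval [Fintype D.N] (a : D.Cherednik) :
    ∃ p : D.N → MvPolynomial ι (PolyFun V), a = ∑ w,
      WeylPair.leftEval D.polyToCherednik.toRingHom (D.genYPoly b) (p w) * D.genN w := by
  classical
  have ha : a ∈ Submodule.span (PolyFun V)
      {a : D.Cherednik | ∃ s w, a = D.symToCherednik s * D.genN w} := by
    rw [span_sym_genN]; exact Submodule.mem_top
  induction ha using Submodule.span_induction with
  | mem a ha =>
    obtain ⟨s, w, rfl⟩ := ha
    refine ⟨Pi.single w (MvPolynomial.map (algebraMap ℂ (PolyFun V))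
      (SymmetricAlgebra.equivMvPolynomial b s)), ?_⟩
    rw [Finset.sum_eq_single w]
    · rw [Pi.single_eq_same, WeylPair.leftEval_map, genYPoly_equiv]
      exact D.polyToCherednik.commutes
    · intro w' _ hw
      rw [Pi.single_eq_of_ne hw, map_zero, zero_mul]
    · intro h; exact absurd (Finset.mem_univ w) h
  | zero => exact ⟨0, by simp⟩
  | add a a' _ _ ha ha' =>
    obtain ⟨p, rfl⟩ := ha
    obtain ⟨p', rfl⟩ := ha'
    exact ⟨p + p', by simp only [Pi.add_apply, map_add, add_mul, Finset.sum_add_distrib]⟩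
  | smul r a _ ha =>
    obtain ⟨p, rfl⟩ := ha
    refine ⟨fun w => MvPolynomial.C r * p w, ?_⟩
    rw [poly_smul_def, Finset.mul_sum]
    refine Finset.sum_congr rfl fun w _ => ?_
    rw [WeylPair.leftEval_C_mul, mul_assoc]
    rfl

end

variable [FiniteDimensional ℂ V]

attribute [local instance 10] ringDXSkew

theorem dunklRep_comp_genYPoly {ι : Type*} (b : Module.Basis ι ℂ V) :
    D.dunklRep.comp (D.genYPoly b) = D.dunklPoly b := by
  apply MvPolynomial.algHom_ext
  intro i
  rw [AlgHom.comp_apply, genYPoly_X, dunklPoly_X]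
  exact D.dunklRep_genY (b i)

/-- A normally ordered sum goes to the same sum in the T^β w. These are independent over ℂ[X], and
ℂ[V] embeds in ℂ[X]. -/
theorem dunklRep_injective : Function.Injective D.dunklRep := by
  refine (injective_iff_map_eq_zero _).2 fun a ha => ?_
  have : Fintype D.N := Fintype.ofFinite _
  let b := Module.finBasis ℂ V
  obtain ⟨p, rfl⟩ := D.exists_eq_sum_leftEval b a
  rw [map_sum] at ha
  have hmap : ∀ w, D.dunklRep (WeylPair.leftEval D.polyToCherednik.toRingHom (D.genYPoly b) (p w) *
      D.genN w) = WeylPair.leftEval D.fnHom.toRingHom (D.dunklPoly b)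
        (MvPolynomial.map (algebraMap (PolyFun V) D.CX) (p w)) * D.gp w := fun w => by
    rw [map_mul, dunklRep_genN, ← dunklRep_comp_genYPoly,
      WeylPair.map_leftEval _ _ D.dunklRep D.fnHom.toRingHom _ D.dunklRep_polyToCherednik]
  simp only [hmap] at ha
  have hp := D.eq_zero_of_sum_leftEval b _ ha
  refine Finset.sum_eq_zero fun w _ => ?_
  have hw : p w = 0 :=
    MvPolynomial.map_injective _ D.algebraMap_CX_injective ((congrFun hp w).trans (map_zero _).symm)
  rw [hw, map_zero, zero_mul]

end ReflectionPair
end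

noncomputable section

namespace ReflectionPair

variable {V : Type*} [AddCommGroup V] [Module ℂ V] (D : ReflectionPair V)

/-! ### The Ore condition for the powers of `δ` -/

/-- W permutes its hyperplanes and sends each α_H to a multiple of α_{gH}, so δ is semi-invariant.
-/
theorem polyAct_δ {g : V ≃ₗ[ℂ] V} (hg : g ∈ D.W) : ∃ c : ℂ, polyAct g D.δ = c • D.δ := by
  choose! c hc h using fun H (hH : H ∈ D.hyperplanes) =>
    D.exists_dualAct_α hg (D.mem_hyperplanes.1 hH)
  have h0 : polyAct g D.δ =
      ∏ H ∈ D.hyperplanes, polyAct g (SymmetricAlgebra.ι ℂ _ (D.α H)) := map_prod _ _ _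
  have h1 : ∏ H ∈ D.hyperplanes, polyAct g (SymmetricAlgebra.ι ℂ _ (D.α H)) =
      ∏ H ∈ D.hyperplanes,
        c H • SymmetricAlgebra.ι ℂ _ (D.α (H.map (g : V →ₗ[ℂ] V))) :=
    Finset.prod_congr rfl fun H hH => by rw [polyAct_ι, h H hH, map_smul]
  have h2 : ∏ H ∈ D.hyperplanes, SymmetricAlgebra.ι ℂ _ (D.α (H.map (g : V →ₗ[ℂ] V))) = D.δ := by
    have hg' := D.W.inv_mem hg
    have hinv : ∀ u, g⁻¹ (g u) = u := g.symm_apply_apply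
    have hinv' : ∀ u, g (g⁻¹ u) = u := g.apply_symm_apply
    refine Finset.prod_nbij' (fun H => H.map (g : V →ₗ[ℂ] V))
      (fun H => H.map ((g⁻¹ : V ≃ₗ[ℂ] V) : V →ₗ[ℂ] V)) ?_ ?_ ?_ ?_ ?_
    · exact fun H hH => D.mem_hyperplanes.2 (map_mem_arrangement hg (D.mem_hyperplanes.1 hH))
    · exact fun H hH => D.mem_hyperplanes.2 (map_mem_arrangement hg' (D.mem_hyperplanes.1 hH))
    · intro H _
      rw [← Submodule.map_comp]
      convert! Submodule.map_id H
      exact LinearMap.ext hinv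
    · intro H _
      rw [← Submodule.map_comp]
      convert! Submodule.map_id H
      exact LinearMap.ext hinv'
    · exact fun _ _ => rfl
  refine ⟨∏ H ∈ D.hyperplanes, c H, ?_⟩
  rw [h0, h1, Finset.prod_smul, h2]

/-- The element `δ` of `A(W₀, W)`. -/
abbrev genδ : D.Cherednik := D.polyToCherednik D.δ

/-- The elements that can be moved past the powers of `δ`. -/
def δNormal : Subalgebra ℂ D.Cherednik where
  carrier := {a | ∀ n, ∃ a', D.genδ ^ n * a = a' * D.genδ ^ n}
  mul_mem' := by
    intro a b ha hb n
    obtain ⟨a', ha⟩ := ha n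
    obtain ⟨b', hb⟩ := hb n
    exact ⟨a' * b', by rw [← mul_assoc, ha, mul_assoc, hb, mul_assoc]⟩
  add_mem' := by
    intro a b ha hb n
    obtain ⟨a', ha⟩ := ha n
    obtain ⟨b', hb⟩ := hb n
    exact ⟨a' + b', by rw [mul_add, ha, hb, add_mul]⟩
  algebraMap_mem' c _ := ⟨algebraMap ℂ _ c, (Algebra.commutes _ _).symm⟩

theorem genX_mem_δNormal (x : Module.Dual ℂ V) : D.genX x ∈ D.δNormal := fun n =>
  ⟨D.genX x, by rw [← polyToCherednik_ι, ← map_pow, ← map_mul, mul_comm, map_mul]⟩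

theorem genN_mem_δNormal (w : D.N) : D.genN w ∈ D.δNormal := fun n => by
  -- The scalar is taken for w⁻¹: from w⁻¹ δ^n = c^n δ^n w⁻¹, multiplication by w on both sides
  -- gives δ^n w = c^n w δ^n.
  obtain ⟨c, hc⟩ := D.polyAct_δ (D.N_le (w⁻¹).2)
  refine ⟨c ^ n • D.genN w, ?_⟩
  have h := D.genN_mul_poly w⁻¹ (D.δ ^ n)
  have hw : D.genN w * D.genN w⁻¹ = 1 := by rw [← genN_mul, mul_inv_cancel, genN_one]
  have hw' : D.genN w⁻¹ * D.genN w = 1 := by rw [← genN_mul, inv_mul_cancel, genN_one]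
  rw [map_pow (polyAct _), hc, smul_pow, map_smul, map_pow] at h
  calc D.genδ ^ n * D.genN w = D.genN w * (D.genN w⁻¹ * D.genδ ^ n) * D.genN w := by
        rw [← mul_assoc, hw, one_mul]
    _ = c ^ n • D.genN w * D.genδ ^ n := by
        rw [h, mul_assoc, mul_assoc, hw', mul_one, mul_smul_comm, smul_mul_assoc]

/-- Let yδ = δy + b with b in `δNormal`. Then δ^{n+2} y = δ^{n+1}(yδ - b), where induction applies
to δ^{n+1} y and b is moved past δ^{n+1}. Only one power of δ is lost in all. -/
theorem genδ_pow_succ_mul_genY (y : V) (n : ℕ) :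
    ∃ a, D.genδ ^ (n + 1) * D.genY y = a * D.genδ ^ n := by
  obtain ⟨-, b, hb, h⟩ :=
    D.commutator_mem D.δNormal D.genX_mem_δNormal D.genN_mem_δNormal y D.δ
  induction n with
  | zero => exact ⟨D.genδ ^ 1 * D.genY y, by rw [pow_zero, mul_one]⟩
  | succ n ih =>
    obtain ⟨a, ha⟩ := ih
    obtain ⟨b', hb'⟩ := hb (n + 1)
    refine ⟨a - b', ?_⟩
    rw [pow_succ, mul_assoc, ← sub_eq_iff_eq_add.2 h, mul_sub, ← mul_assoc, ha, hb', sub_mul,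
      mul_assoc, ← pow_succ]

/-- The elements satisfying the condition for every n form a subalgebra: exponents are chained for
products and added for sums. So it suffices to check generators. -/
theorem exists_genδ_pow_mul (a : D.Cherednik) (n : ℕ) :
    ∃ m a', D.genδ ^ m * a = a' * D.genδ ^ n := by
  let S : Subalgebra ℂ D.Cherednik :=
    { carrier := {a | ∀ n, ∃ m a', D.genδ ^ m * a = a' * D.genδ ^ n}
      mul_mem' := by
        intro a b ha hb n
        obtain ⟨m, b', hb⟩ := hb n
        obtain ⟨k, a', ha⟩ := ha m
        exact ⟨k, a' * b', by rw [← mul_assoc, ha, mul_assoc, hb, mul_assoc]⟩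
      add_mem' := by
        intro a b ha hb n
        obtain ⟨m, b', hb⟩ := hb n
        obtain ⟨k, a', ha⟩ := ha n
        refine ⟨m + k, D.genδ ^ m * a' + D.genδ ^ k * b', ?_⟩
        rw [mul_add, pow_add, mul_assoc, ha, ← pow_add, add_comm m k, pow_add, mul_assoc, hb,
          add_mul, mul_assoc, mul_assoc]
      algebraMap_mem' := fun c n => ⟨n, algebraMap ℂ _ c, (Algebra.commutes _ _).symm⟩ }
  have hS := D.subalgebra_cherednik_eq_top S (fun x n => ⟨n, D.genX_mem_δNormal x n⟩)
    (fun y n => ⟨n + 1, D.genδ_pow_succ_mul_genY y n⟩) (fun w n => ⟨n, D.genN_mem_δNormal w n⟩)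
  have ha : a ∈ S := hS ▸ Algebra.mem_top
  exact ha n

/-- The inverse of `δ` in `ℂ[X]`. -/
abbrev invδ : D.CX := IsLocalization.Away.invSelf D.δ

theorem δ_mul_invδ : algebraMap (PolyFun V) D.CX D.δ * D.invδ = 1 :=
  IsLocalization.Away.mul_invSelf D.δ

theorem exists_eq_invδ_pow_mul (f : D.CX) :
    ∃ (n : ℕ) (p : PolyFun V), f = p • D.invδ ^ n := by
  obtain ⟨n, p, h⟩ := IsLocalization.Away.surj D.δ f
  refine ⟨n, p, ?_⟩
  rw [Algebra.smul_def, ← h, mul_assoc, ← mul_pow, δ_mul_invδ, one_pow, mul_one]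

theorem invδ_pow_eq_smul (n m : ℕ) : D.invδ ^ n = D.δ ^ m • D.invδ ^ (n + m) := by
  rw [Algebra.smul_def, map_pow, pow_add, mul_left_comm, ← mul_pow, δ_mul_invδ, one_pow, mul_one]

/-- Common denominators: polynomial numerators cross the tensor sign. Hence injectivity need only be
tested on elements δ^{-n} ⊗ a. -/
theorem exists_eq_invδ_pow_tmul (t : D.CX ⊗[PolyFun V] D.Cherednik) :
    ∃ (n : ℕ) (a : D.Cherednik), t = (D.invδ ^ n) ⊗ₜ a := by
  induction t with
  | zero => exact ⟨0, 0, (TensorProduct.tmul_zero _ _).symm⟩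
  | tmul f a =>
    obtain ⟨n, p, rfl⟩ := D.exists_eq_invδ_pow_mul f
    exact ⟨n, p • a, TensorProduct.smul_tmul _ _ _⟩
  | add t t' ht ht' =>
    obtain ⟨n, a, rfl⟩ := ht
    obtain ⟨m, b, rfl⟩ := ht'
    refine ⟨n + m, D.δ ^ m • a + D.δ ^ n • b, ?_⟩
    rw [TensorProduct.tmul_add, ← TensorProduct.smul_tmul, ← TensorProduct.smul_tmul,
      ← invδ_pow_eq_smul, add_comm n m, ← invδ_pow_eq_smul]

/-! ### The localization -/

variable [FiniteDimensional ℂ V]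

attribute [local instance 10] ringDXSkew

theorem isUnit_dunklRep (s : Submonoid.powers D.genδ) :
    IsUnit (D.dunklRep (s : D.Cherednik)) := by
  obtain ⟨_, n, rfl⟩ := s
  change IsUnit (D.dunklRep (D.genδ ^ n))
  rw [map_pow, dunklRep_polyToCherednik]
  exact (D.isUnit_algebraMap_δ.map D.fnHom).pow n

/-- The powers of `δ` form a left Ore set in `A(W₀, W)`. -/
@[reducible] def oreSetδ : OreLocalization.OreSet (Submonoid.powers D.genδ) where
  -- δ is in fact a non-zero-divisor on the right, because its image is a unit and `dunklRep` is
  -- injective; so no further factor is needed.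
  ore_right_cancel a b s h := ⟨1, by
    have : a = b := D.dunklRep_injective <| (D.isUnit_dunklRep s).mul_right_cancel <| by
      rw [← map_mul, ← map_mul, h]
    rw [this]⟩
  -- `s.2.choose` is an exponent n with s = δ^n.
  oreNum a s := (D.exists_genδ_pow_mul a s.2.choose).choose_spec.choose
  oreDenom a s := ⟨D.genδ ^ (D.exists_genδ_pow_mul a s.2.choose).choose, _, rfl⟩
  ore_eq a s := by
    have h : D.genδ ^ s.2.choose = s := s.2.choose_spec
    have h' := (D.exists_genδ_pow_mul a s.2.choose).choose_spec.choose_spec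
    exact h'.trans (congrArg _ h)

attribute [local instance] oreSetδ

/-- The localization `A(W₀, W)[δ⁻¹]`. -/
abbrev CherednikReg := OreLocalization (Submonoid.powers D.genδ) D.Cherednik

/-- The powers of `δ`, as units of `𝒟(X) ⋊ N`. -/
def unitsδ : Submonoid.powers D.genδ →* (D.DXSkew)ˣ :=
  IsUnit.liftRight ((D.dunklRep : D.Cherednik →* D.DXSkew).comp (Submonoid.subtype _))
    D.isUnit_dunklRep

theorem coe_unitsδ (s : Submonoid.powers D.genδ) :
    (D.unitsδ s : D.DXSkew) = D.dunklRep s := IsUnit.coe_liftRight _ _ s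

/-- The extension of the Dunkl representation to `A(W₀, W)[δ⁻¹]`. -/
def dunklRepReg : D.CherednikReg →ₐ[ℂ] D.DXSkew :=
  { OreLocalization.universalHom D.dunklRep.toRingHom D.unitsδ
      (fun s => (D.coe_unitsδ s).symm) with
    commutes' := fun c =>
      (OreLocalization.universalHom_commutes _ _ _).trans (D.dunklRep.commutes c) }

theorem dunklRepReg_oreDiv (a : D.Cherednik) (s : Submonoid.powers D.genδ) :
    D.dunklRepReg (OreLocalization.oreDiv a s) = ((D.unitsδ s)⁻¹ : (D.DXSkew)ˣ) * D.dunklRep a :=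
  rfl

theorem dunklRepReg_numeratorHom (a : D.Cherednik) :
    D.dunklRepReg (OreLocalization.numeratorHom a) = D.dunklRep a :=
  OreLocalization.universalHom_commutes _ _ _

theorem dunklRepReg_oreDiv_pow (a : D.Cherednik) (n : ℕ) :
    D.dunklRepReg (OreLocalization.oreDiv a
      (⟨D.genδ ^ n, n, rfl⟩ : Submonoid.powers D.genδ)) =
      D.fnHom (D.invδ ^ n) * D.dunklRep a := by
  rw [dunklRepReg_oreDiv, Units.inv_mul_eq_iff_eq_mul, coe_unitsδ, ← mul_assoc]
  have : D.dunklRep (D.genδ ^ n) * D.fnHom (D.invδ ^ n) = 1 := by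
    rw [map_pow, dunklRep_polyToCherednik, ← map_pow, ← map_mul, ← mul_pow, δ_mul_invδ, one_pow,
      map_one]
  rw [this, one_mul]

theorem dunklRepReg_injective : Function.Injective D.dunklRepReg := by
  refine (injective_iff_map_eq_zero _).2 fun z hz => ?_
  induction z using OreLocalization.ind with
  | _ a s =>
    rw [dunklRepReg_oreDiv, Units.mul_right_eq_zero, map_eq_zero_iff _ D.dunklRep_injective] at hz
    rw [hz, OreLocalization.zero_oreDiv]

theorem dunklRepReg_surjective : Function.Surjective D.dunklRepReg := by
  rw [← AlgHom.range_eq_top]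
  have hA : ∀ a, D.dunklRep a ∈ D.dunklRepReg.range := fun a =>
    ⟨_, D.dunklRepReg_numeratorHom a⟩
  have hf : ∀ f, D.fnHom f ∈ D.dunklRepReg.range := fun f => by
    obtain ⟨n, p, rfl⟩ := D.exists_eq_invδ_pow_mul f
    refine ⟨_, (D.dunklRepReg_oreDiv_pow (D.polyToCherednik p) n).trans ?_⟩
    rw [dunklRep_polyToCherednik, ← map_mul, mul_comm, Algebra.smul_def]
  have hN : ∀ w, D.gp w ∈ D.dunklRepReg.range := fun w => D.dunklRep_genN w ▸ hA _
  have hG : ∀ a, D.groupToDXSkew a ∈ D.dunklRepReg.range := fun a => by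
    induction a using MonoidAlgebra.induction_on with
    | of w => rw [groupToDXSkew_of]; exact hN w
    | add a b ha hb => rw [map_add]; exact Subalgebra.add_mem _ ha hb
    | smul c a ha => rw [map_smul]; exact Subalgebra.smul_mem _ ha c
  refine D.subalgebra_DXSkew_eq_top _ (fun θ => ?_) hN
  have htop : D.dunklRepReg.range.comap D.opHom = ⊤ := by
    refine D.subalgebra_DX_eq_top _ hf fun y => ?_
    change D.opHom (D.partialOp y) ∈ D.dunklRepReg.range
    -- ∂_y is T_y minus terms in ℂ[X] and ℂN, all of which are in the image.
    rw [← sub_eq_iff_eq_add.2 (D.dunkl_eq y)]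
    refine Subalgebra.sub_mem _ (D.dunklRep_genY y ▸ hA _) (Subalgebra.sum_mem _ fun H _ => ?_)
    exact Subalgebra.smul_mem _ (Subalgebra.mul_mem _ (hf _) (hG _)) _
  have : θ ∈ D.dunklRepReg.range.comap D.opHom := htop ▸ Algebra.mem_top
  exact this

/-- The isomorphism between `A(W₀, W)[δ⁻¹]` and `𝒟(X) ⋊ N`. -/
def dunklRepEquiv : D.CherednikReg ≃ₐ[ℂ] D.DXSkew :=
  AlgEquiv.ofBijective D.dunklRepReg ⟨D.dunklRepReg_injective, D.dunklRepReg_surjective⟩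

/-- The map `f ⊗ a ↦ f Φ(a)` from `ℂ[X] ⊗ A(W₀, W)` to `𝒟(X) ⋊ N`. -/
def mulDXSkew : D.CX ⊗[PolyFun V] D.Cherednik →+ D.DXSkew :=
  TensorProduct.liftAddHom
    ((AddMonoidHom.mul.comp (D.fnHom : D.CX →+ D.DXSkew)).compr₂ (AddMonoidHom.id _) |>.compl₂
      (D.dunklRep : D.Cherednik →+ D.DXSkew))
    fun p f a => by
      change D.fnHom (p • f) * D.dunklRep a = D.fnHom f * D.dunklRep (p • a)
      rw [dunklRep_smul, Algebra.smul_def, mul_comm, map_mul, mul_assoc]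

theorem mulDXSkew_tmul (f : D.CX) (a : D.Cherednik) :
    D.mulDXSkew (f ⊗ₜ a) = D.fnHom f * D.dunklRep a := rfl

/-- On δ^{-n} ⊗ a the map agrees with the extended Dunkl representation on the fraction δ^{-n}a.
Injectivity thus reduces to that of `dunklRep`, and surjectivity to that of `dunklRepReg`. -/
theorem mulDXSkew_bijective : Function.Bijective D.mulDXSkew := by
  constructor
  · refine (injective_iff_map_eq_zero _).2 fun t ht => ?_
    obtain ⟨n, a, rfl⟩ := D.exists_eq_invδ_pow_tmul t
    rw [mulDXSkew_tmul, ← dunklRepReg_oreDiv_pow, dunklRepReg_oreDiv,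
      Units.mul_right_eq_zero, map_eq_zero_iff _ D.dunklRep_injective] at ht
    rw [ht, TensorProduct.tmul_zero]
  · intro P
    obtain ⟨z, rfl⟩ := D.dunklRepReg_surjective P
    induction z using OreLocalization.ind with
    | _ a s =>
      obtain ⟨_, n, rfl⟩ := s
      exact ⟨(D.invδ ^ n) ⊗ₜ a, (D.dunklRepReg_oreDiv_pow a n).symm⟩

/-- The identification of `ℂ[X] ⊗ A(W₀, W)` with `A(W₀, W)[δ⁻¹]`. -/
def tensorEquiv : D.CX ⊗[PolyFun V] D.Cherednik ≃+ D.CherednikReg :=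
  (AddEquiv.ofBijective D.mulDXSkew D.mulDXSkew_bijective).trans
    D.dunklRepEquiv.symm.toAddEquiv

theorem dunklRepEquiv_tensorEquiv (t : D.CX ⊗[PolyFun V] D.Cherednik) :
    D.dunklRepEquiv (D.tensorEquiv t) = D.mulDXSkew t :=
  D.dunklRepEquiv.apply_symm_apply _

theorem tensorEquiv_tmul (n : ℕ) (a : D.Cherednik) :
    D.tensorEquiv ((D.invδ ^ n) ⊗ₜ a) = OreLocalization.oreDiv a
      (⟨D.genδ ^ n, n, rfl⟩ : Submonoid.powers D.genδ) :=
  D.dunklRepEquiv.injective <|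
    (D.dunklRepEquiv_tensorEquiv _).trans (D.dunklRepReg_oreDiv_pow a n).symm

end ReflectionPair
end

/-! ### The Dunkl embedding and its localization. -/

theorem mainTheorem6 {V : Type*} [AddCommGroup V] [Module ℂ V] [FiniteDimensional ℂ V]
    (D : ReflectionPair V) :
    ∃ Φ : D.Cherednik →ₐ[ℂ] D.DXSkew,
      (∀ x : Module.Dual ℂ V, Φ (D.genX x) = D.fn (D.coord x)) ∧
      (∀ y : V, Φ (D.genY y) = D.dunkl y) ∧
      (∀ w : D.N, Φ (D.genN w) = SkewMonoidAlgebra.of D.DX D.N w) ∧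
      Function.Injective Φ ∧
      -- the powers of `δ` form a (left) Ore set in `A(W₀, W)`
      ∃ _ : OreLocalization.OreSet (Submonoid.powers (D.polyToCherednik D.δ)),
      -- the underlying `ℂ[V]`-module of the localization is `ℂ[X] ⊗ A(W₀, W)`
      ∃ e : D.CX ⊗[PolyFun V] D.Cherednik ≃+
          OreLocalization (Submonoid.powers (D.polyToCherednik D.δ)) D.Cherednik,
        (∀ (n : ℕ) (a : D.Cherednik),
          e (((IsLocalization.Away.invSelf D.δ : D.CX) ^ n) ⊗ₜ[PolyFun V] a) =
            OreLocalization.oreDiv a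
              (⟨D.polyToCherednik D.δ ^ n, n, rfl⟩ :
                Submonoid.powers (D.polyToCherednik D.δ))) ∧
      ∃ Φreg : OreLocalization (Submonoid.powers (D.polyToCherednik D.δ)) D.Cherednik
          ≃ₐ[ℂ] D.DXSkew,
        (∀ a : D.Cherednik, Φreg (OreLocalization.numeratorHom a) = Φ a) ∧
        (∀ (f : D.CX) (a : D.Cherednik), Φreg (e (f ⊗ₜ[PolyFun V] a)) = D.fn f * Φ a) :=
  ⟨D.dunklRep, D.dunklRep_genX, D.dunklRep_genY, D.dunklRep_genN, D.dunklRep_injective, D.oreSetδ,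
    D.tensorEquiv, D.tensorEquiv_tmul, D.dunklRepEquiv, D.dunklRepReg_numeratorHom,
    fun f a => D.dunklRepEquiv_tensorEquiv (f ⊗ₜ a)⟩
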